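/- Let $D$ be a domain (a nonempty connected open set) in $\mathbb{R}^n$, $n\ge 2$. For a map $f:D\to\mathbb{R}^n$ and a point $x\in D$ at which all first partial derivatives of $f$ exist, let $f'(x)$ be the Jacobian matrix, $\|f'(x)\|=\sup_{|h|=1}|f'(x)h|$ and $J_f(x)=\det f'(x)$. Put $K_f(x)=\|f'(x)\|^n/|J_f(x)|$ if $J_f(x)\ne 0$, $K_f(x)=1$ if $f'(x)=0$, and $K_f(x)=\infty$ at all other points of $D$ (including the points where some first partial derivative does not exist), and let $P_f(x)=K_f(x)^{1/(n-1)}$. Let $f_j$, $j=1,2,\dots$, be homeomorphisms of $D$ into $\mathbb{R}^n$ (i.e. onto their images) of the Sobolev class $W^{1,1}_{\mathrm{loc}}(D)$, converging locally uniformly in $D$ to a mapping $f:D\to\mathbb{R}^n$ which is differentiable almost everywhere in $D$. Suppose that there is a function $P\in L^1_{\mathrm{loc}}(D)$ such that $P_{f_j}(x)\le P(x)$ for a.e. $x\in D$ and all $j=1,2,\dots$. Then $$P_f(x)\le\limsup_{j\to\infty}P_{f_j}(x)\qquad\text{for a.e. }x\in D .$$ Moreover, if $f$ is a homeomorphism (of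 $D$ onto its image), then $f\in W^{1,1}_{\mathrm{loc}}(D)$ and, for every $i=1,\dots,n$, the distributional derivatives satisfy $\partial_i f_j\to\partial_i f$ weakly in $L^1_{\mathrm{loc}}(D)$ as $j\to\infty$, i.e. $\int_D \varphi\,\partial_i f_j\,dm\to\int_D\varphi\,\partial_i f\,dm$ (component-wise) for every $\varphi\in L^\infty(D)$ with compact support in $D$. -/

import Mathlib

open MeasureTheory Filter Topology
open scoped ENNReal ContDiff

noncomputable section

namespace Dilatation

variable {n : ℕ}

/-- The `i`-th vector of the standard basis of `ℝⁿ`. -/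
abbrev e (i : Fin n) : EuclideanSpace ℝ (Fin n) := EuclideanSpace.single i 1

/-- `f` has all the first partial derivatives at the point `x`. -/
def HasPartials (f : EuclideanSpace ℝ (Fin n) → EuclideanSpace ℝ (Fin n))
    (x : EuclideanSpace ℝ (Fin n)) : Prop :=
  ∀ i : Fin n, LineDifferentiableAt ℝ f x (e i)

/-- The Jacobian matrix `f'(x) = (∂ᵢ fₖ (x))ₖᵢ` of the (ordinary) first partial derivatives. -/
def jacobian (f : EuclideanSpace ℝ (Fin n) → EuclideanSpace ℝ (Fin n))
    (x : EuclideanSpace ℝ (Fin n)) : Matrix (Fin n) (Fin n) ℝ :=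
  Matrix.of fun k i => lineDeriv ℝ f x (e i) k

/-- The operator norm `sup_{|h| = 1} |A h|` of a matrix with respect to the Euclidean norm. -/
def opNorm (A : Matrix (Fin n) (Fin n) ℝ) : ℝ :=
  ‖Matrix.toEuclideanCLM (n := Fin n) (𝕜 := ℝ) A‖

open Classical in
/-- The outer dilatation `K_f(x) ∈ [0, ∞]`: it is `‖f'(x)‖ⁿ / |J_f(x)|` if `J_f(x) ≠ 0`,
it is `1` if `f'(x) = 0`, and it is `∞` at all the other points, including the points where
some first partial derivative does not exist. -/
def outerDilatation (f : EuclideanSpace ℝ (Fin n) → EuclideanSpace ℝ (Fin n))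
    (x : EuclideanSpace ℝ (Fin n)) : ℝ≥0∞ :=
  if HasPartials f x then
    if (jacobian f x).det ≠ 0 then
      ENNReal.ofReal (opNorm (jacobian f x) ^ n / |(jacobian f x).det|)
    else if jacobian f x = 0 then 1 else ∞
  else ∞

/-- The dilatation `P_f = K_f ^ (1 / (n - 1))`. -/
def dilatationP (f : EuclideanSpace ℝ (Fin n) → EuclideanSpace ℝ (Fin n))
    (x : EuclideanSpace ℝ (Fin n)) : ℝ≥0∞ :=
  outerDilatation f x ^ (1 / ((n : ℝ) - 1))

/-- The locally integrable function `v` is the distributional derivative of the locally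
integrable function `u` in the `i`-th variable in the open set `U`. -/
structure IsWeakPartial (U : Set (EuclideanSpace ℝ (Fin n))) (i : Fin n)
    (u v : EuclideanSpace ℝ (Fin n) → ℝ) : Prop where
  locallyIntegrable_fun : LocallyIntegrableOn u U
  locallyIntegrable_deriv : LocallyIntegrableOn v U
  integral_eq : ∀ φ : EuclideanSpace ℝ (Fin n) → ℝ,
    ContDiff ℝ ∞ φ → HasCompactSupport φ → tsupport φ ⊆ U →
      ∫ x in U, u x * lineDeriv ℝ φ x (e i) = - ∫ x in U, v x * φ x

/-- The class `W^{1,1}_loc(U)` of vector functions, in the component-wise sense. -/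
def MemW11Loc (U : Set (EuclideanSpace ℝ (Fin n)))
    (f : EuclideanSpace ℝ (Fin n) → EuclideanSpace ℝ (Fin n)) : Prop :=
  ∀ k : Fin n, LocallyIntegrableOn (fun x => f x k) U ∧
    ∀ i : Fin n, ∃ v : EuclideanSpace ℝ (Fin n) → ℝ, IsWeakPartial U i (fun x => f x k) v

/-- `G j → g` weakly in `L¹_loc(U)`: all these functions are locally integrable in `U`, and
`∫ G j * φ → ∫ g * φ` for every essentially bounded function `φ` with compact support in `U`. -/
def TendstoWeaklyL1Loc (U : Set (EuclideanSpace ℝ (Fin n)))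
    (G : ℕ → EuclideanSpace ℝ (Fin n) → ℝ) (g : EuclideanSpace ℝ (Fin n) → ℝ) : Prop :=
  (∀ j, LocallyIntegrableOn (G j) U) ∧ LocallyIntegrableOn g U ∧
    ∀ φ : EuclideanSpace ℝ (Fin n) → ℝ,
      MemLp φ ∞ volume → HasCompactSupport φ → tsupport φ ⊆ U →
        Tendsto (fun j => ∫ x in U, G j x * φ x) atTop (𝓝 (∫ x in U, g x * φ x))

/-- The restriction of `f` to `U` is a homeomorphism of `U` onto its image. -/
def IsHomeoInto (U : Set (EuclideanSpace ℝ (Fin n)))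
    (f : EuclideanSpace ℝ (Fin n) → EuclideanSpace ℝ (Fin n)) : Prop :=
  IsEmbedding (U.domRestrict f)

end Dilatation

end

/-! Write P_j, F_j', J_j for the dilatation, the Jacobian matrix and the Jacobian of the j-th map.
Since P_j is finite a.e., the partial derivatives exist a.e. and ‖F_j'‖^n ≤ P_j^(n-1) |J_j|. Young's
inequality linearizes this: for every t > 0, ‖F_j'‖ ≤ c₁ P_j + c₂ |J_j| with c₁ = (n-1)t/n and c₂ =
t^(1-n)/n. Both terms can be integrated: P_j is dominated by P, and the integral of |J_j| over S is
at most the volume of F_j(S), because F_j is injective (`lintegral_abs_det_jacobian_le`).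

Semicontinuity is a blow-up at a point x₀ where f is differentiable. Pair F_j with a derivative of a
bump function living on a small ball B around x₀, and integrate by parts. As j → ∞ the pairing tends
to that of f, which is nearly ⟨a, f'(x₀)h⟩ times the integral of the bump. The upper bound involves
the integral of P_j over B, asymptotically at most limsup P_j(x₀) · |B| by reverse Fatou and
Lebesgue differentiation, and the volume of F_j(B), asymptotically at most |J_f(x₀)| · |B| by
uniform convergence. Hence ‖f'(x₀)‖ ≤ c₁ H + c₂ |J_f(x₀)| with H = limsup P_j(x₀), and the best t
returns ‖f'(x₀)‖^n ≤ H^(n-1) |J_f(x₀)| (`opNorm_pow_le_of_eventually_lintegral_le`).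

For weak convergence, the distortion inequality gives |∂F_j|² ≤ p(p + |J_j|) with p = max(P, 1), so
the derivatives are bounded in L² after division by one fixed weight w with w² locally integrable
(`exists_weight`). Convergence on smooth test functions follows by moving the derivative to the test
function, and Hilbert space weak compactness extends it to all bounded compactly supported φ
(`exists_weak_limit_of_weighted_bound`).

Two facts link ordinary and distributional derivatives: a continuous map with partial derivatives
a.e. is Lipschitz on countably many pieces covering almost everything, which gives the area
inequality; and weak partial derivatives agree a.e. with ordinary ones where these exist a.e.
(`IsWeakPartial.ae_eq_lineDeriv`). -/

namespace Dilatation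

/-! ### Density points of slices of a measurable set. -/

section SliceDensity

variable {V W : Type*} [NormedAddCommGroup V] [NormedSpace ℝ V] [FiniteDimensional ℝ V]
  [MeasurableSpace V] [BorelSpace V] [NormedAddCommGroup W] [NormedSpace ℝ W]
  [FiniteDimensional ℝ W] [MeasurableSpace W] [BorelSpace W]

/-- Radii run over ℚ and scales over ℕ so that the density condition is built from these sets by
countable operations and stays measurable. -/
theorem measurableSet_slice_bound (μ : Measure V) [μ.IsAddHaarMeasure] {L : V → W}
    (hL : Continuous L) {T : Set W} (hT : MeasurableSet T) (m : ℕ) (r : ℚ) (ε : ℝ≥0∞) :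
    MeasurableSet {x : W | 0 < r → (r : ℝ) < 1 / ((m : ℝ) + 1) →
      μ {u | u ∈ Metric.closedBall (0 : V) r ∧ x + L u ∉ T} ≤
        ε * μ (Metric.closedBall (0 : V) r)} := by
  by_cases h1 : 0 < r
  · by_cases h2 : (r : ℝ) < 1 / ((m : ℝ) + 1)
    · simp only [h1, h2, true_imp_iff]
      have hs : MeasurableSet {p : W × V | p.2 ∈ Metric.closedBall (0 : V) r ∧
          p.1 + L p.2 ∉ T} := by
        apply MeasurableSet.inter
        · exact measurable_snd Metric.isClosed_closedBall.measurableSet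
        · have : Measurable fun p : W × V => p.1 + L p.2 :=
            measurable_fst.add (hL.measurable.comp measurable_snd)
          exact this hT.compl
      exact measurableSet_le (measurable_measure_prodMk_left hs) measurable_const
    · simp only [h2, false_imp_iff, imp_true_iff]
      exact MeasurableSet.univ
  · simp only [h1, false_imp_iff]
    exact MeasurableSet.univ

/-- Almost every point of a measurable set is a density point of its slices along a linear map. -/
theorem ae_slice_density (μ : Measure V) [μ.IsAddHaarMeasure] (ν : Measure W)
    [ν.IsAddHaarMeasure] (L : V →ₗ[ℝ] W) {T : Set W} (hT : MeasurableSet T)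
    {ε : ℝ≥0∞} (hε : ε ≠ 0) :
    ∀ᵐ x ∂ν, x ∈ T → ∃ m : ℕ, ∀ r : ℚ, 0 < r → (r : ℝ) < 1 / ((m : ℝ) + 1) →
      μ {u | u ∈ Metric.closedBall (0 : V) r ∧ x + L u ∉ T} ≤
        ε * μ (Metric.closedBall (0 : V) r) := by
  have hL : Continuous L := L.continuous_of_finiteDimensional
  -- By Fubini it suffices to treat, for each y, almost every point of the slice u ↦ y + L u; there
  -- the claim is the Lebesgue density theorem.
  refine ae_mem_of_ae_add_linearMap_mem L μ ν
    (s := {x | x ∈ T → ∃ m : ℕ, ∀ r : ℚ, 0 < r → (r : ℝ) < 1 / ((m : ℝ) + 1) →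
      μ {u | u ∈ Metric.closedBall (0 : V) r ∧ x + L u ∉ T} ≤
        ε * μ (Metric.closedBall (0 : V) r)}) ?_ ?_
  · have : MeasurableSet (Tᶜ ∪ ⋃ m : ℕ, ⋂ r : ℚ, {x : W | 0 < r → (r : ℝ) < 1 / ((m : ℝ) + 1) →
        μ {u | u ∈ Metric.closedBall (0 : V) r ∧ x + L u ∉ T} ≤
        ε * μ (Metric.closedBall (0 : V) r)}) := by
      refine hT.compl.union (MeasurableSet.iUnion fun m => MeasurableSet.iInter fun r => ?_)
      exact measurableSet_slice_bound μ hL hT m r ε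
    convert this using 1
    ext x
    simp only [Set.mem_ofPred_eq, Set.mem_union, Set.mem_compl_iff, Set.mem_iUnion, Set.mem_iInter]
    tauto
  · intro y
    have hτ : MeasurableSet {u | y + L u ∈ T} :=
      (measurable_const.add hL.measurable : Measurable fun u => y + L u) hT
    filter_upwards [Besicovitch.ae_tendsto_measure_inter_div_of_measurableSet μ hτ.compl] with u hu
    intro huT
    have h0 : ({u | y + L u ∈ T}ᶜ).indicator (1 : V → ℝ≥0∞) u = 0 :=
      Set.indicator_of_notMem (fun h : u ∈ {u | y + L u ∈ T}ᶜ => (Set.mem_compl_iff _ _).1 h huT) _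
    rw [h0] at hu
    have h1 := hu.eventually (gt_mem_nhds (pos_iff_ne_zero.2 hε))
    obtain ⟨δ, hδ, hδ'⟩ := mem_nhdsGT_iff_exists_Ioo_subset.1 h1
    obtain ⟨m, hm⟩ := exists_nat_one_div_lt (show (0 : ℝ) < δ from hδ)
    refine ⟨m, fun r hr hrm => ?_⟩
    have hr' : (0 : ℝ) < r := by exact_mod_cast hr
    have h2 := hδ' ⟨hr', hrm.trans hm⟩
    simp only [Set.mem_ofPred_eq] at h2
    have h3 : {v | v ∈ Metric.closedBall (0 : V) r ∧ y + L u + L v ∉ T} =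
        (fun v => u + v) ⁻¹' ({u | y + L u ∈ T}ᶜ ∩ Metric.closedBall u r) := by
      ext v
      simp [add_assoc, and_comm]
    rw [h3, measure_preimage_add, ← Measure.addHaar_closedBall_center μ u]
    rw [ENNReal.div_lt_iff] at h2
    · exact h2.le
    · left; exact (Metric.measure_closedBall_pos μ u hr').ne'
    · left; exact measure_closedBall_lt_top.ne

end SliceDensity

variable {n : ℕ}

local notation "E" => EuclideanSpace ℝ (Fin n)

/-! ### Decomposition into Lipschitz pieces of a continuous map with partial derivatives. -/

section LipschitzPieces

/-- Up to a null set, `S` is a countable union of measurable subsets satisfying `G`. -/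
def CoveredAE (G : Set E → Prop) (S : Set E) : Prop :=
  ∃ T : ℕ → Set E, (∀ k, MeasurableSet (T k) ∧ T k ⊆ S ∧ G (T k)) ∧
    volume (S \ ⋃ k, T k) = 0

theorem CoveredAE.trans {G G' : Set E → Prop} {S : Set E} (h : CoveredAE G S)
    (h' : ∀ T, MeasurableSet T → T ⊆ S → G T → CoveredAE G' T) : CoveredAE G' S := by
  obtain ⟨T, hT, hS⟩ := h
  choose R hR hR' using fun k => h' (T k) (hT k).1 (hT k).2.1 (hT k).2.2
  refine ⟨fun k => R k.unpair.1 k.unpair.2, fun k => ⟨(hR _ _).1,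
    (hR _ _).2.1.trans (hT _).2.1, (hR _ _).2.2⟩, ?_⟩
  refine measure_mono_null (t := (S \ ⋃ k, T k) ∪ ⋃ k, (T k \ ⋃ l, R k l)) ?_ ?_
  · intro x hx
    by_cases hxT : x ∈ ⋃ k, T k
    · right
      obtain ⟨k, hk⟩ := Set.mem_iUnion.1 hxT
      refine Set.mem_iUnion.2 ⟨k, hk, fun hl => hx.2 ?_⟩
      obtain ⟨l, hl⟩ := Set.mem_iUnion.1 hl
      exact Set.mem_iUnion.2 ⟨Nat.pair k l, by simpa using hl⟩
    · exact Or.inl ⟨hx.1, hxT⟩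
  · exact measure_union_null hS (measure_iUnion_null hR')

/-- The orthogonal projection on the first `d` coordinates. -/
def headProj (n d : ℕ) : EuclideanSpace ℝ (Fin n) →ₗ[ℝ] EuclideanSpace ℝ (Fin n) where
  toFun x := WithLp.toLp 2 fun i => if i.val < d then x i else 0
  map_add' x y := by ext i; by_cases h : i.val < d <;> simp [h]
  map_smul' c x := by ext i; by_cases h : i.val < d <;> simp [h]

theorem headProj_apply (d : ℕ) (x : E) (i : Fin n) :
    headProj n d x i = if i.val < d then x i else 0 := rfl

theorem headProj_headProj (d : ℕ) (x : E) : headProj n d (headProj n d x) = headProj n d x := by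
  ext i; by_cases h : i.val < d <;> simp [headProj_apply, h]

theorem norm_headProj_le (d : ℕ) (x : E) : ‖headProj n d x‖ ≤ ‖x‖ := by
  rw [EuclideanSpace.norm_eq, EuclideanSpace.norm_eq]
  apply Real.sqrt_le_sqrt
  apply Finset.sum_le_sum
  intro i _
  by_cases h : i.val < d <;> simp [headProj_apply, h, sq_nonneg]

theorem headProj_eq_self {d : ℕ} (hd : n ≤ d) (x : E) : headProj n d x = x := by
  ext i; simp [headProj_apply, i.2.trans_le hd]

theorem sub_headProj_eq {d : ℕ} (hd : d < n) {x : E} (hx : headProj n (d + 1) x = x) :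
    x - headProj n d x = x ⟨d, hd⟩ • e ⟨d, hd⟩ := by
  ext i
  have hi := congrArg (fun y : E => y i) hx
  simp only [headProj_apply] at hi
  by_cases h1 : i.val < d
  · have : i ≠ ⟨d, hd⟩ := fun h => by simp [h] at h1
    simp [headProj_apply, h1, this]
  · by_cases h2 : i.val = d
    · have : i = ⟨d, hd⟩ := Fin.ext h2
      subst this
      simp [headProj_apply]
    · have h3 : ¬ i.val < d + 1 := by omega
      have : i ≠ ⟨d, hd⟩ := fun h => by simp [h] at h2
      simp only [h3, if_false] at hi
      simp [headProj_apply, h1, this, ← hi]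

/-- Lipschitz control at a small scale between points of `T` that differ only in the first `d`
coordinates, and from points of `T` in the coordinate directions. -/
def HeadLipschitz (f : E → E) (d : ℕ) (T : Set E) : Prop :=
  ∃ L δ : ℝ, 0 ≤ L ∧ 0 < δ ∧
    (∀ x ∈ T, ∀ i, ∀ t : ℝ, |t| < δ → ‖f (x + t • e i) - f x‖ ≤ L * |t|) ∧
    ∀ x ∈ T, ∀ y ∈ T, headProj n d (x - y) = x - y → ‖x - y‖ < δ → ‖f x - f y‖ ≤ L * ‖x - y‖

/-- Two points x, y that differ in the first d + 1 coordinates are joined through points x', y' of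
T, where x' - x and y' - y involve only the first d coordinates and x' - y' is parallel to `e d`.
The outer links use the inductive Lipschitz bound, the middle one the bound in coordinate
directions. Such x', y' exist when x and y are density points of the d-dimensional slices of T. -/
theorem HeadLipschitz.succ {f : E → E} {d : ℕ} (hd : d < n) {T : Set E} (hT : MeasurableSet T)
    (h : HeadLipschitz f d T) : CoveredAE (HeadLipschitz f (d + 1)) T := by
  obtain ⟨L, δ, hL, hδ, hpart, hlip⟩ := h
  -- The bad sets are measured in a ball of radius 2r, of volume 2^n times that of radius r. Each
  -- then takes at most a quarter of the smaller ball's volume, and two of them cannot cover it.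
  set ε : ℝ≥0∞ := ENNReal.ofReal (1 / (4 * 2 ^ n)) with hε
  have hε0 : ε ≠ 0 := by
    rw [hε, Ne, ENNReal.ofReal_eq_zero, not_le]; positivity
  have hdens := ae_slice_density (volume : Measure E) (volume : Measure E) (headProj n d) hT hε0
  set R : ℕ → Set E := fun m => {x | x ∈ T ∧ ∀ r : ℚ, 0 < r → (r : ℝ) < 1 / ((m : ℝ) + 1) →
      volume {u | u ∈ Metric.closedBall (0 : E) r ∧ x + headProj n d u ∉ T} ≤
        ε * volume (Metric.closedBall (0 : E) r)} with hR
  have hcont : Continuous (headProj n d) := (headProj n d).continuous_of_finiteDimensional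
  refine ⟨R, fun m => ⟨?_, fun x hx => hx.1, ?_⟩, ?_⟩
  · have h2 : R m = T ∩ ⋂ r : ℚ, {x : E | 0 < r → (r : ℝ) < 1 / ((m : ℝ) + 1) →
        volume {u | u ∈ Metric.closedBall (0 : E) r ∧ x + headProj n d u ∉ T} ≤
        ε * volume (Metric.closedBall (0 : E) r)} := by
      ext x; simp [hR]
    rw [h2]
    refine hT.inter (MeasurableSet.iInter fun r => ?_)
    exact measurableSet_slice_bound volume hcont hT m r ε
  · set η := min δ (1 / ((m : ℝ) + 1)) with hη
    have hη0 : 0 < η := lt_min hδ (by positivity)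
    -- With ‖x - y‖ < r < 2‖x - y‖ the three links cost at most 2L, L and 4L times ‖x - y‖. The
    -- factor 1/8 keeps 2r below both δ and the density scale.
    refine ⟨7 * L, η / 8, by positivity, by positivity, ?_, ?_⟩
    · intro x hx i t ht
      have : |t| < δ := by have := min_le_left δ (1 / ((m : ℝ) + 1)); linarith
      have h1 := hpart x hx.1 i t this
      nlinarith [abs_nonneg t, mul_nonneg hL (abs_nonneg t)]
    · intro x hx y hy hxy hlt
      rcases eq_or_ne x y with rfl | hne
      · simp
      have hpos : 0 < ‖x - y‖ := norm_pos_iff.2 (sub_ne_zero.2 hne)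
      obtain ⟨r, hr1, hr2⟩ := exists_rat_btwn (show ‖x - y‖ < 2 * ‖x - y‖ by linarith)
      have hr0 : (0 : ℝ) < r := hpos.trans hr1
      have hr0' : 0 < r := by exact_mod_cast hr0
      have hηδ : η ≤ δ := min_le_left _ _
      have hηm : η ≤ 1 / ((m : ℝ) + 1) := min_le_right _ _
      have hB : ε * volume (Metric.closedBall (0 : E) ((2 * r : ℚ) : ℝ)) =
          ENNReal.ofReal (1 / 4) * volume (Metric.closedBall (0 : E) r) := by
        push_cast
        rw [Measure.addHaar_closedBall_mul volume _ (by norm_num : (0 : ℝ) ≤ 2) hr0.le,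
          finrank_euclideanSpace_fin, ← mul_assoc, hε, ← ENNReal.ofReal_mul (by positivity)]
        congr 2
        field_simp
      have bx := hx.2 (2 * r) (by positivity) (by push_cast; linarith)
      have bY := hy.2 (2 * r) (by positivity) (by push_cast; linarith)
      rw [hB] at bx bY
      set Bx := {u | u ∈ Metric.closedBall (0 : E) ((2 * r : ℚ) : ℝ) ∧ x + headProj n d u ∉ T}
      set By := {u | u ∈ Metric.closedBall (0 : E) ((2 * r : ℚ) : ℝ) ∧ y + headProj n d u ∉ T}
      have hBy : volume ((fun u => u + (x - y)) ⁻¹' By) = volume By := measure_preimage_add_right _ _ _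
      have hlt' : volume (Bx ∪ (fun u => u + (x - y)) ⁻¹' By) <
          volume (Metric.closedBall (0 : E) r) := by
        refine (measure_union_le _ _).trans_lt ?_
        rw [hBy]
        refine (add_le_add bx bY).trans_lt ?_
        rw [← add_mul, ← ENNReal.ofReal_add (by norm_num) (by norm_num)]
        have hv0 : volume (Metric.closedBall (0 : E) r) ≠ 0 :=
          (Metric.measure_closedBall_pos _ _ hr0).ne'
        have hv1 : volume (Metric.closedBall (0 : E) r) ≠ ⊤ := measure_closedBall_lt_top.ne
        conv_rhs => rw [← one_mul (volume (Metric.closedBall (0 : E) r))]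
        rw [ENNReal.mul_lt_mul_iff_left hv0 hv1]
        rw [← ENNReal.ofReal_one]
        exact (ENNReal.ofReal_lt_ofReal_iff (by norm_num)).2 (by norm_num)
      -- One u serves both points: shifting it by x - y for the second makes the displacements
      -- cancel in all of the first d coordinates.
      obtain ⟨u, hu, hu'⟩ : ∃ u ∈ Metric.closedBall (0 : E) r,
          u ∉ Bx ∪ (fun u => u + (x - y)) ⁻¹' By := by
        by_contra! hcon
        exact absurd (measure_mono hcon) (not_le.2 hlt')
      rw [Set.mem_union, not_or] at hu'
      have hun : ‖u‖ ≤ r := by simpa using hu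
      have hux : x + headProj n d u ∈ T := by
        by_contra hc
        exact hu'.1 ⟨by simp only [mem_closedBall_zero_iff]; push_cast; linarith, hc⟩
      have hu2 : ‖u + (x - y)‖ ≤ 2 * r := (norm_add_le _ _).trans (by linarith)
      have huy : y + headProj n d (u + (x - y)) ∈ T := by
        by_contra hc
        exact hu'.2 ⟨by simp only [mem_closedBall_zero_iff]; push_cast; exact hu2, hc⟩
      set x' := x + headProj n d u with hx'
      set y' := y + headProj n d (u + (x - y)) with hy'
      have d1 : x' - x = headProj n d u := by simp [hx']
      have d2 : y' - y = headProj n d (u + (x - y)) := by simp [hy']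
      have n1 := (norm_headProj_le d u).trans hun
      have n2 := (norm_headProj_le d (u + (x - y))).trans hu2
      have e1 := hlip x' hux x hx.1 (by rw [d1, headProj_headProj]) (by rw [d1]; linarith)
      have e2 := hlip y' huy y hy.1 (by rw [d2, headProj_headProj]) (by rw [d2]; linarith)
      rw [d1] at e1
      rw [d2] at e2
      have d3 : x' = y' + (x - y) ⟨d, hd⟩ • e ⟨d, hd⟩ := by
        rw [← sub_headProj_eq hd hxy, hx', hy', map_add]; abel
      have ht : |(x - y) ⟨d, hd⟩| ≤ ‖x - y‖ := by
        simpa using PiLp.norm_apply_le (x - y) ⟨d, hd⟩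
      have e3 := hpart y' huy ⟨d, hd⟩ ((x - y) ⟨d, hd⟩) (by linarith)
      rw [← d3] at e3
      have tri : ‖f x - f y‖ ≤ ‖f x' - f x‖ + ‖f x' - f y'‖ + ‖f y' - f y‖ := by
        have : f x - f y = -(f x' - f x) + (f x' - f y') + (f y' - f y) := by abel
        rw [this]
        exact (norm_add₃_le).trans (by rw [norm_neg])
      nlinarith [mul_le_mul_of_nonneg_left n1 hL, mul_le_mul_of_nonneg_left n2 hL,
        mul_le_mul_of_nonneg_left ht hL, mul_le_mul_of_nonneg_left hr2.le hL]
  · refine measure_mono_null ?_ hdens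
    intro x hx
    simp only [Set.mem_compl_iff, Set.mem_ofPred_eq]
    intro hc
    obtain ⟨m, hm⟩ := hc hx.1
    exact hx.2 (Set.mem_iUnion.2 ⟨m, hx.1, hm⟩)

theorem CoveredAE.of_countable {G : Set E → Prop} {S : Set E} {ι : Type*} [Countable ι] [Nonempty ι]
    (T : ι → Set E) (hT : ∀ k, MeasurableSet (T k) ∧ T k ⊆ S ∧ G (T k)) (hS : S ⊆ ⋃ k, T k) :
    CoveredAE G S := by
  obtain ⟨φ, hφ⟩ := exists_surjective_nat ι
  refine ⟨fun k => T (φ k), fun k => hT _, ?_⟩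
  rw [hφ.iUnion_comp, Set.sdiff_eq_empty.2 hS, measure_empty]

theorem HeadLipschitz.coveredAE_of_le {f : E → E} {T : Set E} (hT : MeasurableSet T)
    (h : HeadLipschitz f 0 T) {d : ℕ} (hd : d ≤ n) : CoveredAE (HeadLipschitz f d) T := by
  induction d with
  | zero =>
    exact CoveredAE.of_countable (fun _ : Unit => T) (fun _ => ⟨hT, subset_rfl, h⟩)
      (Set.subset_iUnion (fun _ : Unit => T) ())
  | succ d ih => exact (ih (by omega)).trans fun R hR _ hR' => hR'.succ (by omega) hR

/-- A continuous map having first partial derivatives on a measurable set is Lipschitz on countably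
many pieces that fill this set up to a null set. -/
theorem coveredAE_lipschitzOnWith_of_continuous {f : E → E} (hf : Continuous f) {S : Set E}
    (hS : MeasurableSet S) (hpart : ∀ x ∈ S, HasPartials f x) :
    CoveredAE (fun T => ∃ K : NNReal, LipschitzOnWith K f T) S := by
  -- For d = 0 the second clause of `HeadLipschitz` compares a point only with itself. What remains
  -- is a bound on difference quotients, which defines a closed set for each m because f is
  -- continuous.
  have h1 : CoveredAE (HeadLipschitz f 0) S := by
    refine CoveredAE.of_countable (fun m : ℕ => S ∩ {x | ∀ (i : Fin n) (t : ℝ),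
      |t| < 1 / ((m : ℝ) + 1) → ‖f (x + t • e i) - f x‖ ≤ m * |t|}) (fun m => ⟨?_, ?_, ?_⟩) ?_
    · refine hS.inter (IsClosed.measurableSet ?_)
      simp only [Set.ofPred_forall]
      refine isClosed_iInter fun i => isClosed_iInter fun t => isClosed_iInter fun _ => ?_
      exact isClosed_le (by fun_prop) continuous_const
    · exact Set.inter_subset_left
    · refine ⟨m, 1 / ((m : ℝ) + 1), by positivity, by positivity, fun x hx => hx.2, ?_⟩
      intro x _ y _ hxy _
      have h0 : x - y = 0 := by
        rw [← hxy]; ext i; simp [headProj_apply]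
      rw [sub_eq_zero.1 h0]; simp
    · intro x hx
      have h2 : ∀ i : Fin n, ∃ C δ : ℝ, 0 < δ ∧ ∀ t : ℝ, |t| < δ →
          ‖f (x + t • e i) - f x‖ ≤ C * |t| := by
        intro i
        have h3 : DifferentiableAt ℝ (fun t : ℝ => f (x + t • e i)) 0 := hpart x hx i
        obtain ⟨C, hC⟩ := h3.isBigO_sub.bound
        obtain ⟨δ, hδ, hδ'⟩ := Metric.eventually_nhds_iff.1 hC
        refine ⟨C, δ, hδ, fun t ht => ?_⟩
        simpa using hδ' (y := t) (by simpa using ht)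
      choose C δ hδ hC using h2
      obtain ⟨m, hm⟩ : ∃ m : ℕ, ∀ i, C i ≤ m ∧ 1 / ((m : ℝ) + 1) < δ i := by
        have h4 : ∀ i, ∀ᶠ m : ℕ in atTop, C i ≤ m ∧ 1 / ((m : ℝ) + 1) < δ i := fun i =>
          (tendsto_natCast_atTop_atTop.eventually_ge_atTop (C i)).and
            (tendsto_one_div_add_atTop_nhds_zero_nat.eventually_lt_const (hδ i))
        exact (eventually_all.2 h4).exists
      refine Set.mem_iUnion.2 ⟨m, hx, fun i t ht => ?_⟩
      exact (hC i t (ht.trans (hm i).2)).trans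
        (mul_le_mul_of_nonneg_right (hm i).1 (abs_nonneg t))
  refine h1.trans fun T hT _ hT0 => (hT0.coveredAE_of_le hT le_rfl).trans fun R hR _ hR' => ?_
  obtain ⟨L, δ, hL, hδ, -, hlip⟩ := hR'
  -- The Lipschitz bound holds only at distances below δ; cutting into pieces of diameter less than
  -- δ makes it unconditional.
  refine CoveredAE.of_countable (fun k : ℕ => R ∩ Metric.ball (TopologicalSpace.denseSeq E k) (δ / 2))
    (fun k => ⟨hR.inter Metric.isOpen_ball.measurableSet, Set.inter_subset_left, ⟨L, hL⟩, ?_⟩) ?_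
  · refine LipschitzOnWith.of_dist_le_mul fun x hx y hy => ?_
    rw [dist_eq_norm, dist_eq_norm]
    refine hlip x hx.1 y hy.1 (headProj_eq_self le_rfl _) ?_
    rw [← dist_eq_norm]
    have h3 := dist_triangle_right x y (TopologicalSpace.denseSeq E k)
    have h4 : dist x (TopologicalSpace.denseSeq E k) < δ / 2 := hx.2
    have h5 : dist y (TopologicalSpace.denseSeq E k) < δ / 2 := hy.2
    linarith
  · intro x hx
    obtain ⟨k, hk⟩ := (TopologicalSpace.denseRange_denseSeq E).exists_dist_lt x (half_pos hδ)
    exact Set.mem_iUnion.2 ⟨k, hx, hk⟩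

theorem HasPartials.congr {f g : E → E} {x : E} (h : f =ᶠ[𝓝 x] g) (hf : HasPartials f x) :
    HasPartials g x := fun i => h.lineDifferentiableAt_iff.1 (hf i)

/-- Localization of the global result: D is a countable union of balls, on each of which f agrees
with a Tietze extension that is continuous everywhere; the null set without partial derivatives is
discarded. -/
theorem coveredAE_lipschitzOnWith {f : E → E} {D : Set E} (hD : IsOpen D) (hf : ContinuousOn f D)
    (hpart : ∀ᵐ x ∂volume.restrict D, HasPartials f x) :
    CoveredAE (fun T => ∃ K : NNReal, LipschitzOnWith K f T) D := by
  rcases D.eq_empty_or_nonempty with rfl | hne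
  · exact CoveredAE.of_countable (fun _ : Unit => ∅) (fun _ => ⟨MeasurableSet.empty, subset_rfl,
      0, by simp⟩) (Set.empty_subset _)
  have hloc : ∀ x ∈ D, ∃ ρ > 0, Metric.closedBall x ρ ⊆ D := fun x hx =>
    Metric.nhds_basis_closedBall.mem_iff.1 (hD.mem_nhds hx)
  choose! ρ hρ hρD using hloc
  obtain ⟨t, htD, htc, ht⟩ := TopologicalSpace.countable_cover_nhdsWithin
    (f := fun x => Metric.ball x (ρ x)) (s := D)
    fun x hx => mem_nhdsWithin_of_mem_nhds (Metric.ball_mem_nhds x (hρ x hx))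
  have : Countable t := htc.to_subtype
  have : Nonempty t := by
    obtain ⟨x, hx⟩ := hne
    obtain ⟨y, hy, -⟩ := Set.mem_iUnion₂.1 (ht hx)
    exact ⟨⟨y, hy⟩⟩
  have h1 : CoveredAE (fun T => ∃ x ∈ D, T = Metric.ball x (ρ x)) D :=
    CoveredAE.of_countable (fun y : t => Metric.ball (y : E) (ρ y))
      (fun y => ⟨Metric.isOpen_ball.measurableSet,
        Metric.ball_subset_closedBall.trans (hρD y (htD y.2)), y, htD y.2, rfl⟩)
      (by rwa [Set.iUnion_subtype])
  refine h1.trans ?_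
  rintro _ - - ⟨x, hx, rfl⟩
  rw [ae_restrict_iff' hD.measurableSet] at hpart
  obtain ⟨N, hN, hNm, hN0⟩ := exists_measurable_superset_of_null hpart
  obtain ⟨g, hg⟩ := ContinuousMap.exists_restrict_eq (Metric.isClosed_closedBall (x := x) (ε := ρ x))
    ⟨(Metric.closedBall x (ρ x)).domRestrict f,
      continuousOn_iff_continuous_domRestrict.1 (hf.mono (hρD x hx))⟩
  have hgf : Set.EqOn f g (Metric.ball x (ρ x)) := fun y hy => by
    have := congrArg (fun k => k ⟨y, Metric.ball_subset_closedBall hy⟩) hg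
    exact this.symm
  have h2 := coveredAE_lipschitzOnWith_of_continuous g.continuous
    (Metric.isOpen_ball.measurableSet.diff hNm : MeasurableSet (Metric.ball x (ρ x) \ N)) (by
      intro y hy
      have h3 : HasPartials f y := by
        by_contra hc
        exact hy.2 (hN fun h4 => hc (h4 (hρD x hx (Metric.ball_subset_closedBall hy.1))))
      exact h3.congr (hgf.eventuallyEq_of_mem (Metric.isOpen_ball.mem_nhds hy.1)))
  obtain ⟨T, hT, hT0⟩ := h2
  refine ⟨T, fun k => ⟨(hT k).1, (hT k).2.1.trans Set.sdiff_subset, ?_⟩, ?_⟩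
  · obtain ⟨K, hK⟩ := (hT k).2.2
    refine ⟨K, fun y hy z hz => ?_⟩
    rw [hgf ((hT k).2.1 hy).1, hgf ((hT k).2.1 hz).1]
    exact hK hy hz
  · refine measure_mono_null ?_ (measure_union_null hT0 hN0)
    intro y hy
    by_cases hyN : y ∈ N
    · exact Or.inr hyN
    · exact Or.inl ⟨⟨hy.1, hyN⟩, hy.2⟩

end LipschitzPieces

/-! ### The area inequality. -/

section Area

/-- The Jacobian matrix as an operator. -/
noncomputable def jacobianCLM (f : E → E) (x : E) : E →L[ℝ] E :=
  Matrix.toEuclideanCLM (n := Fin n) (𝕜 := ℝ) (jacobian f x)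

theorem det_toEuclideanCLM (A : Matrix (Fin n) (Fin n) ℝ) :
    (Matrix.toEuclideanCLM (n := Fin n) (𝕜 := ℝ) A).det = A.det := by
  rw [ContinuousLinearMap.det, Matrix.coe_toEuclideanCLM_eq_toEuclideanLin,
    Matrix.toEuclideanLin, Matrix.toLpLin_eq_toLin,
    LinearMap.det_toLin]

theorem jacobianCLM_apply_e (f : E → E) (x : E) (i : Fin n) :
    jacobianCLM f x (e i) = lineDeriv ℝ f x (e i) := by
  ext k
  simp [jacobianCLM, jacobian, Matrix.ofLp_toEuclideanCLM]

theorem clm_ext_e {A B : E →L[ℝ] E} (h : ∀ i, A (e i) = B (e i)) : A = B := by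
  apply ContinuousLinearMap.coe_injective
  refine (EuclideanSpace.basisFun (Fin n) ℝ).toBasis.ext fun i => ?_
  simpa using h i

/-- If 0 were isolated, the slice would miss a punctured interval, against density one half. The
accumulation makes one-dimensional derivatives within the slice unique. -/
theorem ae_accPt_line {T : Set E} (hT : MeasurableSet T) (v : E) :
    ∀ᵐ x : E, x ∈ T → AccPt (0 : ℝ) (𝓟 {t : ℝ | x + t • v ∈ T}) := by
  have h := ae_slice_density (volume : Measure ℝ) (volume : Measure E)
    (LinearMap.toSpanSingleton ℝ E v) hT (ε := ENNReal.ofReal (1 / 2)) (by simp)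
  filter_upwards [h] with x hx hxT
  obtain ⟨m, hm⟩ := hx hxT
  rw [accPt_iff_frequently_nhdsNE]
  intro hc
  rw [eventually_nhdsWithin_iff, Metric.eventually_nhds_iff] at hc
  obtain ⟨δ, hδ, hδ'⟩ := hc
  obtain ⟨r, hr0, hr1⟩ := exists_rat_btwn (show (0 : ℝ) < min δ (1 / ((m : ℝ) + 1)) from
    lt_min hδ (by positivity))
  have h1 := hm r (by exact_mod_cast hr0) (hr1.trans_le (min_le_right _ _))
  have h2 : Metric.closedBall (0 : ℝ) r \ {0} ⊆ {u | u ∈ Metric.closedBall (0 : ℝ) r ∧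
      x + LinearMap.toSpanSingleton ℝ E v u ∉ T} := by
    intro u hu
    refine ⟨hu.1, ?_⟩
    exact hδ' (y := u) ((Metric.mem_closedBall.1 hu.1).trans_lt (hr1.trans_le (min_le_left _ _)))
      hu.2
  have h3 := (measure_mono h2).trans h1
  rw [measure_sdiff_null (measure_singleton _), Real.volume_closedBall,
    ← ENNReal.ofReal_mul (by norm_num), ENNReal.ofReal_le_ofReal_iff (by positivity)] at h3
  linarith

/-- At almost every point of a set where it is Lipschitz, a map with first partial derivatives is
differentiable within this set, with the expected derivative. -/
theorem ae_hasFDerivWithinAt_jacobianCLM {f : E → E} {T : Set E} (hT : MeasurableSet T)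
    {K : NNReal} (hf : LipschitzOnWith K f T)
    (hpart : ∀ᵐ x ∂volume.restrict T, HasPartials f x) :
    ∀ᵐ x ∂volume.restrict T, HasFDerivWithinAt f (jacobianCLM f x) T x := by
  obtain ⟨g, hg, hfg⟩ := hf.extend_finite_dimension
  have hacc : ∀ᵐ x : E, ∀ i, x ∈ T → AccPt (0 : ℝ) (𝓟 {t : ℝ | x + t • e i ∈ T}) :=
    ae_all_iff.2 fun i => ae_accPt_line hT (e i)
  filter_upwards [hpart, ae_restrict_of_ae (hg.ae_differentiableAt (μ := volume)),
    ae_restrict_of_ae hacc, ae_restrict_mem hT] with x hx hgx hax hxT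
  -- Rademacher's theorem differentiates the extension g, which equals f only on T. The partial
  -- derivatives of f and g are compared along the times t with x + t e_i in T, where derivatives
  -- are unique.
  have : jacobianCLM f x = fderiv ℝ g x := by
    refine clm_ext_e fun i => ?_
    rw [jacobianCLM_apply_e]
    have h1 : HasDerivAt (fun t : ℝ => f (x + t • e i)) (lineDeriv ℝ f x (e i)) 0 :=
      (hx i).hasLineDerivAt
    have h2 : HasDerivAt (fun t : ℝ => g (x + t • e i)) (fderiv ℝ g x (e i)) 0 :=
      hgx.hasFDerivAt.hasLineDerivAt (e i)
    have hu := uniqueDiffWithinAt_iff_accPt.2 (hax i hxT)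
    refine UniqueDiffWithinAt.eq_deriv _ hu h1.hasDerivWithinAt ?_
    refine h2.hasDerivWithinAt.congr (fun t ht => hfg ht) ?_
    exact hfg (by simpa using hxT)
  rw [this]
  exact (hgx.hasFDerivAt.hasFDerivWithinAt).congr hfg (hfg hxT)

theorem coveredAE_hasFDerivWithinAt {f : E → E} {D : Set E} (hD : IsOpen D)
    (hf : ContinuousOn f D) (hpart : ∀ᵐ x ∂volume.restrict D, HasPartials f x) :
    CoveredAE (fun T => ∀ x ∈ T, HasFDerivWithinAt f (jacobianCLM f x) T x) D := by
  refine (coveredAE_lipschitzOnWith hD hf hpart).trans fun T hT hTD ⟨K, hK⟩ => ?_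
  have h := ae_hasFDerivWithinAt_jacobianCLM hT hK
    (ae_mono (Measure.restrict_mono hTD le_rfl) hpart)
  rw [ae_restrict_iff' hT] at h
  obtain ⟨N, hN, hNm, hN0⟩ := exists_measurable_superset_of_null h
  refine ⟨fun _ => T \ N, fun _ => ⟨hT.diff hNm, Set.sdiff_subset, fun x hx => ?_⟩, ?_⟩
  · refine HasFDerivWithinAt.mono ?_ Set.sdiff_subset
    by_contra hc
    exact hx.2 (hN fun h => hc (h hx.1))
  · rw [Set.iUnion_const, Set.sdiff_sdiff_right_self]
    exact measure_mono_null Set.inter_subset_right hN0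

/-- The area inequality for injective continuous maps with first partial derivatives a.e. -/
theorem lintegral_abs_det_jacobian_le {f : E → E} {D : Set E} (hD : IsOpen D)
    (hf : ContinuousOn f D) (hinj : Set.InjOn f D)
    (hpart : ∀ᵐ x ∂volume.restrict D, HasPartials f x) {S : Set E} (hS : MeasurableSet S)
    (hSD : S ⊆ D) :
    ∫⁻ x in S, ENNReal.ofReal |(jacobian f x).det| ≤ volume (f '' S) := by
  obtain ⟨T, hT, hT0⟩ := coveredAE_hasFDerivWithinAt hD hf hpart
  set R : ℕ → Set E := fun k => S ∩ disjointed T k with hR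
  have hRm : ∀ k, MeasurableSet (R k) := fun k =>
    hS.inter (MeasurableSet.disjointed (fun k => (hT k).1) k)
  have hRd : Pairwise (Function.onFun Disjoint R) := fun i j hij =>
    ((disjoint_disjointed T) hij).mono Set.inter_subset_right Set.inter_subset_right
  have hRder : ∀ k, ∀ x ∈ R k, HasFDerivWithinAt f (jacobianCLM f x) (R k) x := fun k x hx =>
    ((hT k).2.2 x (disjointed_subset T k hx.2)).mono
      (Set.inter_subset_right.trans (disjointed_subset T k))
  have hRinj : ∀ k, Set.InjOn f (R k) := fun k => hinj.mono (Set.inter_subset_left.trans hSD)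
  have hunion : ⋃ k, R k = S ∩ ⋃ k, T k := by
    rw [hR, ← Set.inter_iUnion, iUnion_disjointed]
  have h1 : S =ᵐ[volume] (⋃ k, R k : Set E) := by
    rw [hunion]
    refine (ae_eq_set.2 ⟨?_, ?_⟩)
    · refine measure_mono_null ?_ hT0
      intro x hx
      exact ⟨hSD hx.1, fun h => hx.2 ⟨hx.1, h⟩⟩
    · rw [Set.sdiff_eq_empty.2 Set.inter_subset_left, measure_empty]
  rw [setLIntegral_congr h1, lintegral_iUnion hRm hRd]
  have h2 : ∀ k, ∫⁻ x in R k, ENNReal.ofReal |(jacobian f x).det| = volume (f '' R k) := by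
    intro k
    rw [← lintegral_abs_det_fderiv_eq_addHaar_image volume (hRm k) (hRder k) (hRinj k)]
    simp only [jacobianCLM, det_toEuclideanCLM]
  simp only [h2]
  rw [← measure_iUnion]
  -- Equality may fail here: the null set left out by the pieces can have an image of positive
  -- measure.
  · rw [← Set.image_iUnion, hunion]
    exact measure_mono (Set.image_mono Set.inter_subset_left)
  · intro i j hij
    refine Set.disjoint_left.2 ?_
    rintro _ ⟨x, hx, rfl⟩ ⟨y, hy, hxy⟩
    have := hinj (hSD hy.1) (hSD hx.1) hxy
    subst this
    exact Set.disjoint_left.1 (hRd hij) hx hy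
  · intro k
    exact measurable_image_of_fderivWithin (hRm k) (hRder k) (hRinj k)

end Area

/-! ### Weak partial derivatives agree with ordinary ones. -/

section WeakPartial

theorem ae_restrict_of_locally {D : Set E} (hD : IsOpen D) {p : E → Prop}
    (h : ∀ x ∈ D, ∃ ρ > 0, ∀ᵐ y ∂volume.restrict (Metric.ball x ρ), p y) :
    ∀ᵐ y ∂volume.restrict D, p y := by
  rw [ae_restrict_iff' hD.measurableSet]
  refine measure_null_of_locally_null _ fun x hx => ?_
  have hxD : x ∈ D := by
    by_contra hc
    exact hx fun h => absurd h hc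
  obtain ⟨ρ, hρ, hp⟩ := h x hxD
  rw [ae_restrict_iff' Metric.isOpen_ball.measurableSet] at hp
  refine ⟨_, inter_mem_nhdsWithin _ (Metric.ball_mem_nhds x hρ), measure_mono_null ?_ hp⟩
  intro y hy hc
  exact hy.1 fun _ => hc hy.2

theorem integrable_translate_line {w : E → ℝ} (hw : StronglyMeasurable w) (hwi : Integrable w)
    (v : E) (ν : Measure ℝ) [IsFiniteMeasure ν] :
    Integrable (fun p : E × ℝ => w (p.1 + p.2 • v)) (volume.prod ν) := by
  have hm : Measurable fun p : E × ℝ => p.1 + p.2 • v := by fun_prop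
  refine (integrable_prod_iff' (f := fun p : E × ℝ => w (p.1 + p.2 • v))
    (hw.comp_measurable hm).aestronglyMeasurable).2 ⟨Eventually.of_forall fun t => hwi.comp_add_right (t • v), ?_⟩
  have : ∀ t : ℝ, ∫ x : E, ‖w (x + t • v)‖ = ∫ x, ‖w x‖ := fun t =>
    integral_add_right_eq_self (fun x => ‖w x‖) (t • v)
  simp only [this]
  exact integrable_const _

/-- Lebesgue differentiation along almost every line parallel to a vector. -/
theorem ae_tendsto_lineAverage {w : E → ℝ} (hw : StronglyMeasurable w) (hwi : Integrable w)
    (v : E) :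
    ∀ᵐ y, Tendsto (fun m : ℕ => ((m : ℝ) + 1) * ∫ t in (0 : ℝ)..1 / ((m : ℝ) + 1), w (y + t • v))
      atTop (𝓝 (w y)) := by
  have hm : Measurable fun p : E × ℝ => p.1 + p.2 • v := by fun_prop
  -- Fubini reduces the claim to almost every t on almost every line, that is, to one-dimensional
  -- Lebesgue differentiation. The discrete scales 1/(m+1) keep the exceptional set measurable.
  refine (ae_ae_add_linearMap_mem_iff (LinearMap.toSpanSingleton ℝ E v) (volume : Measure ℝ)
    (volume : Measure E) (s := {y | Tendsto (fun m : ℕ => ((m : ℝ) + 1) *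
      ∫ t in (0 : ℝ)..1 / ((m : ℝ) + 1), w (y + t • v)) atTop (𝓝 (w y))}) ?_).1 ?_
  · refine measurableSet_tendsto_fun (fun m => ?_) hw.measurable
    refine measurable_const.mul ?_
    have h0 : (0 : ℝ) ≤ 1 / ((m : ℝ) + 1) := by positivity
    simp only [intervalIntegral.integral_of_le h0]
    exact (StronglyMeasurable.integral_prod_right
      (ν := volume.restrict (Set.Ioc (0 : ℝ) (1 / ((m : ℝ) + 1))))
      (f := fun (y : E) (t : ℝ) => w (y + t • v)) (hw.comp_measurable hm)).measurable
  · have h1 : ∀ᵐ y : E, ∀ N : ℕ, IntegrableOn (fun t : ℝ => w (y + t • v)) (Set.Icc (-N) N) :=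
      ae_all_iff.2 fun N => (integrable_translate_line hw hwi v
        (volume.restrict (Set.Icc (-(N : ℝ)) N))).prod_right_ae
    filter_upwards [h1] with y hy
    have hloc : LocallyIntegrable (fun t : ℝ => w (y + t • v)) := by
      rw [locallyIntegrable_iff]
      intro k hk
      obtain ⟨R, hR⟩ := hk.isBounded.subset_closedBall 0
      obtain ⟨N, hN⟩ := exists_nat_ge R
      refine (hy N).mono_set fun t ht => ?_
      have := hR ht
      rw [mem_closedBall_zero_iff, Real.norm_eq_abs] at this
      exact abs_le.1 (this.trans hN)
    filter_upwards [LocallyIntegrable.ae_hasDerivAt_integral hloc] with t ht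
    have h2 := hasDerivAt_iff_tendsto_slope_zero.1 (ht t)
    have h3 : Tendsto (fun m : ℕ => 1 / ((m : ℝ) + 1)) atTop (𝓝[≠] 0) :=
      tendsto_nhdsWithin_iff.2 ⟨tendsto_one_div_add_atTop_nhds_zero_nat,
        Eventually.of_forall fun m => by simp; positivity⟩
    have h4 := h2.comp h3
    refine h4.congr fun m => ?_
    simp only [Function.comp, LinearMap.toSpanSingleton_apply, intervalIntegral.integral_same,
      sub_zero, smul_eq_mul, one_div, inv_inv]
    congr 1
    have h5 := intervalIntegral.integral_comp_add_left (a := 0) (b := ((m : ℝ) + 1)⁻¹)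
      (fun s : ℝ => w (y + s • v)) t
    rw [add_zero] at h5
    rw [← h5]
    simp only [add_smul, add_assoc]

theorem contDiff_translate {φ : E → ℝ} (hφ : ContDiff ℝ ∞ φ) (c : E) :
    ContDiff ℝ ∞ fun x => φ (x - c) := hφ.comp (contDiff_id.sub contDiff_const)

theorem hasCompactSupport_translate {φ : E → ℝ} (hφ : HasCompactSupport φ) (c : E) :
    HasCompactSupport fun x => φ (x - c) := by
  simpa [Function.comp_def, sub_eq_add_neg] using hφ.comp_homeomorph (Homeomorph.addRight (-c))

theorem tsupport_translate_subset (φ : E → ℝ) (c : E) :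
    tsupport (fun x => φ (x - c)) ⊆ {x | x - c ∈ tsupport φ} :=
  closure_minimal (fun _ hx => subset_tsupport φ hx)
    ((isClosed_tsupport φ).preimage (continuous_id.sub continuous_const))

/-- The fundamental theorem of calculus for weak derivatives, on segments of fixed length. -/
theorem ae_translate_sub_eq_integral {u w : E → ℝ} (hu : Integrable u)
    (hw : StronglyMeasurable w) (hwi : Integrable w) (v : E) {U : Set E} (hU : IsOpen U)
    {b : ℝ} (hb : 0 ≤ b)
    (H : ∀ φ : E → ℝ, ContDiff ℝ ∞ φ → HasCompactSupport φ → tsupport φ ⊆ U →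
      ∀ t ∈ Set.Icc 0 b, ∫ x, u x * fderiv ℝ φ (x - t • v) v = - ∫ x, w x * φ (x - t • v)) :
    ∀ᵐ y, y ∈ U → u (y + b • v) - u y = ∫ t in (0 : ℝ)..b, w (y + t • v) := by
  have hint := integrable_translate_line hw hwi v (volume.restrict (Set.Ioc 0 b))
  have hint' : Integrable fun y => ∫ t in (0 : ℝ)..b, w (y + t • v) := by
    simp only [intervalIntegral.integral_of_le hb]
    exact hint.integral_prod_left
  have huv := hu.comp_add_right (b • v)
  have hall : Integrable fun y => (u (y + b • v) - u y) - ∫ t in (0 : ℝ)..b, w (y + t • v) :=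
    (huv.sub hu).sub hint'
  have key := hU.ae_eq_zero_of_integral_contDiff_smul_eq_zero (μ := volume)
    (f := fun y => (u (y + b • v) - u y) - ∫ t in (0 : ℝ)..b, w (y + t • v))
    (hall.locallyIntegrable.locallyIntegrableOn U) ?_
  · filter_upwards [key] with y hy hyU
    exact sub_eq_zero.1 (hy hyU)
  intro φ hφ hφc hφU
  obtain ⟨C, hC⟩ := hφc.exists_bound_of_continuous hφ.continuous
  have hφ' : Continuous fun x => fderiv ℝ φ x v :=
    (hφ.continuous_fderiv (by simp)).clm_apply continuous_const
  obtain ⟨C', hC'⟩ := (hφc.fderiv_apply ℝ v).exists_bound_of_continuous hφ'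
  have hder : ∀ x : E, ∀ t : ℝ, HasDerivAt (fun t : ℝ => φ (x - t • v))
      (-(fderiv ℝ φ (x - t • v) v)) t := by
    intro x t
    have h1 : HasDerivAt (fun t : ℝ => x - t • v) (-v) t := by
      simpa using ((hasDerivAt_id t).smul_const v).const_sub x
    have h2 := (hφ.differentiable (by simp) (x - t • v)).hasFDerivAt.comp_hasDerivAt t h1
    simpa [Function.comp_def] using h2
  have hftc : ∀ x : E, ∫ t in (0 : ℝ)..b, fderiv ℝ φ (x - t • v) v = φ x - φ (x - b • v) := by
    intro x
    have hc : Continuous fun t : ℝ => fderiv ℝ φ (x - t • v) v :=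
      hφ'.comp (by fun_prop)
    have h1 := intervalIntegral.integral_eq_sub_of_hasDerivAt (a := 0) (b := b)
      (fun t _ => hder x t) (hc.neg.intervalIntegrable _ _)
    rw [intervalIntegral.integral_neg] at h1
    simp only [zero_smul, sub_zero] at h1
    linarith
  have I1 : Integrable fun y => φ y * u (y + b • v) :=
    huv.bdd_mul hφ.continuous.aestronglyMeasurable (Eventually.of_forall hC)
  have I2 : Integrable fun y => φ y * u y :=
    hu.bdd_mul hφ.continuous.aestronglyMeasurable (Eventually.of_forall hC)
  have I3 : Integrable fun y => φ y * ∫ t in (0 : ℝ)..b, w (y + t • v) :=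
    hint'.bdd_mul hφ.continuous.aestronglyMeasurable (Eventually.of_forall hC)
  have I4 : Integrable fun x => u x * φ (x - b • v) :=
    hu.mul_bdd (contDiff_translate hφ _).continuous.aestronglyMeasurable
      (Eventually.of_forall fun x => hC _)
  have I5 : Integrable fun x => u x * φ x :=
    hu.mul_bdd hφ.continuous.aestronglyMeasurable (Eventually.of_forall hC)
  have E1 : ∫ y, φ y * u (y + b • v) = ∫ x, u x * φ (x - b • v) := by
    rw [← integral_sub_right_eq_self (fun y => φ y * u (y + b • v)) (b • v)]
    refine integral_congr_ae (Eventually.of_forall fun x => ?_)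
    simp [mul_comm]
  -- Fubini is used twice: translation moves t from w to φ, the hypothesis `H` trades w for u, and
  -- the t-integral of the derivative of φ telescopes.
  have E2 : ∫ y, φ y * ∫ t in (0 : ℝ)..b, w (y + t • v) =
      ∫ x, u x * (φ (x - b • v) - φ x) := by
    calc ∫ y, φ y * ∫ t in (0 : ℝ)..b, w (y + t • v)
        = ∫ y, ∫ t in Set.Ioc 0 b, φ y * w (y + t • v) := by
          simp only [intervalIntegral.integral_of_le hb, integral_const_mul]
      _ = ∫ t in Set.Ioc 0 b, ∫ y, φ y * w (y + t • v) := by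
          refine integral_integral_swap ?_
          exact hint.bdd_mul (c := C) (hφ.continuous.comp continuous_fst).aestronglyMeasurable
            (Eventually.of_forall fun p => hC _)
      _ = ∫ t in Set.Ioc 0 b, -∫ x, u x * fderiv ℝ φ (x - t • v) v := by
          refine setIntegral_congr_fun measurableSet_Ioc fun t ht => ?_
          rw [H φ hφ hφc hφU t ⟨ht.1.le, ht.2⟩, neg_neg,
            ← integral_sub_right_eq_self (fun y => φ y * w (y + t • v)) (t • v)]
          refine integral_congr_ae (Eventually.of_forall fun x => ?_)
          simp [mul_comm]
      _ = -∫ x, ∫ t in Set.Ioc 0 b, u x * fderiv ℝ φ (x - t • v) v := by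
          rw [integral_neg]
          congr 1
          symm
          refine integral_integral_swap ?_
          have hcc : Continuous fun p : E × ℝ => fderiv ℝ φ (p.1 - p.2 • v) v :=
            hφ'.comp (by fun_prop)
          exact (hu.comp_fst (volume.restrict (Set.Ioc 0 b))).mul_bdd (c := C')
            hcc.aestronglyMeasurable (Eventually.of_forall fun p => hC' _)
      _ = ∫ x, u x * (φ (x - b • v) - φ x) := by
          rw [← integral_neg]
          refine integral_congr_ae (Eventually.of_forall fun x => ?_)
          simp only
          rw [integral_const_mul, ← intervalIntegral.integral_of_le hb, hftc]
          ring
  simp only [smul_eq_mul, mul_sub]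
  rw [integral_sub (f := fun y => φ y * u (y + b • v) - φ y * u y) (I1.sub I2) I3,
    integral_sub I1 I2, E1, E2]
  simp only [mul_sub]
  rw [integral_sub I4 I5]
  simp only [mul_comm (φ _)]
  ring

/-- The weak partial derivative is the ordinary one if the latter exists almost everywhere. -/
theorem IsWeakPartial.ae_eq_lineDeriv {D : Set E} (hD : IsOpen D) {i : Fin n} {u v : E → ℝ}
    (h : IsWeakPartial D i u v)
    (hl : ∀ᵐ x ∂volume.restrict D, LineDifferentiableAt ℝ u x (e i)) :
    ∀ᵐ x ∂volume.restrict D, lineDeriv ℝ u x (e i) = v x := by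
  refine ae_restrict_of_locally hD fun x₀ hx₀ => ?_
  obtain ⟨R, hR, hRD⟩ := Metric.nhds_basis_closedBall.mem_iff.1 (hD.mem_nhds hx₀)
  -- Test functions supported in the ball of radius ρ, shifted by less than ρ, stay supported in the
  -- ball of radius R inside D.
  set ρ := R / 2 with hρ
  have hρ0 : 0 < ρ := half_pos hR
  set B := Metric.closedBall x₀ R with hB
  have hBm : MeasurableSet B := Metric.isClosed_closedBall.measurableSet
  have hBc : IsCompact B := isCompact_closedBall _ _
  -- Globally integrable representatives are needed because the functions get translated along lines
  -- that leave D.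
  have rep : ∀ g : E → ℝ, LocallyIntegrableOn g D → ∃ g' : E → ℝ, StronglyMeasurable g' ∧
      Integrable g' ∧ ∀ᵐ x, x ∈ B → g' x = g x := by
    intro g hg
    have h1 : Integrable (B.indicator g) :=
      (integrable_indicator_iff hBm).2 (hg.integrableOn_compact_subset hRD hBc)
    refine ⟨h1.1.mk _, h1.1.stronglyMeasurable_mk, h1.congr h1.1.ae_eq_mk, ?_⟩
    filter_upwards [h1.1.ae_eq_mk] with x hx hxB
    rw [← hx, Set.indicator_of_mem hxB]
  obtain ⟨u', hu'm, hu'i, hu'⟩ := rep u h.locallyIntegrable_fun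
  obtain ⟨w, hwm, hwi, hw⟩ := rep v h.locallyIntegrable_deriv
  have transfer : ∀ (g g' ψ : E → ℝ), (∀ᵐ x, x ∈ B → g' x = g x) → (∀ x ∉ B, ψ x = 0) →
      ∫ x in D, g x * ψ x = ∫ x, g' x * ψ x := by
    intro g g' ψ hg hψ
    rw [setIntegral_eq_integral_of_forall_compl_eq_zero]
    · refine integral_congr_ae ?_
      filter_upwards [hg] with x hx
      by_cases hxB : x ∈ B
      · simp only [hx hxB]
      · simp only [hψ x hxB, mul_zero]
    · intro x hx
      rw [hψ x fun hxB => hx (hRD hxB), mul_zero]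
  have hnorm : ‖(e i : E)‖ = 1 := by simp
  have key : ∀ m : ℕ, 1 / ((m : ℝ) + 1) < ρ → ∀ᵐ y, y ∈ Metric.ball x₀ ρ →
      u' (y + (1 / ((m : ℝ) + 1)) • e i) - u' y =
        ∫ t in (0 : ℝ)..1 / ((m : ℝ) + 1), w (y + t • e i) := by
    intro m hm
    refine ae_translate_sub_eq_integral hu'i hwm hwi (e i) Metric.isOpen_ball (by positivity) ?_
    intro φ hφ hφc hφU t ht
    have hsub : tsupport (fun x => φ (x - t • e i)) ⊆ B := by
      intro x hx
      have h1 : x - t • e i ∈ Metric.ball x₀ ρ := hφU (tsupport_translate_subset φ _ hx)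
      rw [mem_ball_iff_norm] at h1
      rw [hB, mem_closedBall_iff_norm]
      have h2 : x - x₀ = (x - t • e i - x₀) + t • e i := by abel
      rw [h2]
      refine (norm_add_le _ _).trans ?_
      rw [norm_smul, hnorm, Real.norm_eq_abs, abs_of_nonneg ht.1]
      have := ht.2
      linarith
    have hlin : ∀ x, lineDeriv ℝ (fun x => φ (x - t • e i)) x (e i) =
        fderiv ℝ φ (x - t • e i) (e i) := by
      intro x
      rw [((contDiff_translate hφ _).differentiable (by simp) x).lineDeriv_eq_fderiv,
        fderiv_comp_sub]
    have h3 := h.integral_eq _ (contDiff_translate hφ (t • e i))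
      (hasCompactSupport_translate hφc _) (hsub.trans hRD)
    rw [transfer u u' _ hu', transfer v w _ hw] at h3
    · simpa only [hlin] using h3
    · intro x hx
      exact image_eq_zero_of_notMem_tsupport (f := fun x => φ (x - t • e i)) fun hc => hx (hsub hc)
    · intro x hx
      rw [((contDiff_translate hφ _).differentiable (by simp) x).lineDeriv_eq_fderiv]
      have : x ∉ tsupport (fderiv ℝ fun x => φ (x - t • e i)) := fun hc =>
        hx (hsub (tsupport_fderiv_subset ℝ hc))
      rw [image_eq_zero_of_notMem_tsupport this]
      rfl
  -- Difference quotients evaluate u at shifted points, where it agrees with u' only almost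
  -- everywhere; countably many shifts still cost only a null set.
  have hshift : ∀ᵐ y : E, ∀ m : ℕ, y + (1 / ((m : ℝ) + 1)) • e i ∈ B →
      u' (y + (1 / ((m : ℝ) + 1)) • e i) = u (y + (1 / ((m : ℝ) + 1)) • e i) :=
    ae_all_iff.2 fun m => (measurePreserving_add_right volume
      ((1 / ((m : ℝ) + 1)) • (e i : E))).quasiMeasurePreserving.ae hu'
  refine ⟨ρ, hρ0, ?_⟩
  have hballD : Metric.ball x₀ ρ ⊆ B := fun x hx =>
    Metric.mem_closedBall.2 ((Metric.mem_ball.1 hx).le.trans (by linarith))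
  have hkey : ∀ᵐ y, ∀ m : ℕ, 1 / ((m : ℝ) + 1) < ρ → y ∈ Metric.ball x₀ ρ →
      u' (y + (1 / ((m : ℝ) + 1)) • e i) - u' y =
        ∫ t in (0 : ℝ)..1 / ((m : ℝ) + 1), w (y + t • e i) :=
    ae_all_iff.2 fun m => by
      by_cases hm : 1 / ((m : ℝ) + 1) < ρ
      · filter_upwards [key m hm] with y hy _ using hy
      · exact Eventually.of_forall fun y hm' => absurd hm' hm
  filter_upwards [ae_mono (Measure.restrict_mono (hballD.trans hRD) le_rfl) hl,
    ae_restrict_of_ae hkey, ae_restrict_of_ae hshift, ae_restrict_of_ae hu', ae_restrict_of_ae hw,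
    ae_restrict_of_ae (ae_tendsto_lineAverage hwm hwi (e i)),
    ae_restrict_mem Metric.isOpen_ball.measurableSet] with y h1 h2 h3 h4 h5 h6 hy
  have h7 : HasDerivAt (fun t : ℝ => u (y + t • e i)) (lineDeriv ℝ u y (e i)) 0 :=
    h1.hasLineDerivAt
  have h8 : Tendsto (fun m : ℕ => 1 / ((m : ℝ) + 1)) atTop (𝓝[≠] 0) :=
    tendsto_nhdsWithin_iff.2 ⟨tendsto_one_div_add_atTop_nhds_zero_nat,
      Eventually.of_forall fun m => by simp; positivity⟩
  have h9 := (hasDerivAt_iff_tendsto_slope_zero.1 h7).comp h8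
  rw [← h5 (hballD hy)]
  refine tendsto_nhds_unique h9 (h6.congr' ?_)
  filter_upwards [tendsto_one_div_add_atTop_nhds_zero_nat.eventually_lt_const hρ0] with m hm
  have hyB : y + (1 / ((m : ℝ) + 1)) • e i ∈ B := by
    rw [hB, mem_closedBall_iff_norm]
    have h10 : y + (1 / ((m : ℝ) + 1)) • e i - x₀ = (y - x₀) + (1 / ((m : ℝ) + 1)) • e i := by
      abel
    rw [h10]
    refine (norm_add_le _ _).trans ?_
    rw [norm_smul, hnorm, Real.norm_eq_abs, abs_of_nonneg (by positivity)]
    have := mem_ball_iff_norm.1 hy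
    linarith
  rw [← h2 m hm hy, h3 m hyB, h4 (hballD hy)]
  simp

end WeakPartial

/-! ### The dilatation of a matrix. -/

section MatrixDilatation

theorem opNorm_nonneg (A : Matrix (Fin n) (Fin n) ℝ) : 0 ≤ opNorm A := norm_nonneg _

theorem opNorm_eq_zero {A : Matrix (Fin n) (Fin n) ℝ} : opNorm A = 0 ↔ A = 0 := by
  rw [opNorm, norm_eq_zero]
  exact EmbeddingLike.map_eq_zero_iff

/-- The image of the unit ball lies in the ball of radius `opNorm A`; compare volumes. -/
theorem abs_det_le_opNorm_pow (A : Matrix (Fin n) (Fin n) ℝ) : |A.det| ≤ opNorm A ^ n := by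
  have h1 := Measure.addHaar_image_continuousLinearMap (volume : Measure E)
    (Matrix.toEuclideanCLM (n := Fin n) (𝕜 := ℝ) A) (Metric.ball 0 1)
  have h0 := det_toEuclideanCLM A
  rw [ContinuousLinearMap.det] at h0
  rw [h0] at h1
  have h2 : (Matrix.toEuclideanCLM (n := Fin n) (𝕜 := ℝ) A) '' Metric.ball (0 : E) 1 ⊆
      Metric.closedBall 0 (opNorm A) := by
    rintro _ ⟨x, hx, rfl⟩
    rw [mem_ball_zero_iff] at hx
    rw [mem_closedBall_zero_iff]
    refine ((Matrix.toEuclideanCLM (n := Fin n) (𝕜 := ℝ) A).le_opNorm x).trans ?_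
    exact mul_le_of_le_one_right (norm_nonneg _) hx.le
  have h3 := measure_mono (μ := (volume : Measure E)) h2
  rw [h1, Measure.addHaar_closedBall _ _ (opNorm_nonneg A), finrank_euclideanSpace_fin] at h3
  have hv0 : volume (Metric.ball (0 : E) 1) ≠ 0 := (Metric.measure_ball_pos _ _ one_pos).ne'
  have hv1 : volume (Metric.ball (0 : E) 1) ≠ ⊤ := measure_ball_lt_top.ne
  rw [ENNReal.mul_le_mul_iff_left hv0 hv1,
    ENNReal.ofReal_le_ofReal_iff (pow_nonneg (opNorm_nonneg A) n)] at h3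
  exact h3

/-- The outer dilatation of a matrix. -/
noncomputable def matrixDilatation (A : Matrix (Fin n) (Fin n) ℝ) : ℝ≥0∞ :=
  if A.det ≠ 0 then ENNReal.ofReal (opNorm A ^ n / |A.det|) else if A = 0 then 1 else ⊤

theorem outerDilatation_eq {f : E → E} {x : E} (h : HasPartials f x) :
    outerDilatation f x = matrixDilatation (jacobian f x) := by
  rw [outerDilatation, if_pos h]; rfl

theorem one_le_matrixDilatation (A : Matrix (Fin n) (Fin n) ℝ) : 1 ≤ matrixDilatation A := by
  unfold matrixDilatation
  split_ifs with h1 h2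
  · rw [← ENNReal.ofReal_one]
    refine ENNReal.ofReal_le_ofReal ?_
    rw [one_le_div (abs_pos.2 h1)]
    exact abs_det_le_opNorm_pow A
  · exact le_rfl
  · exact le_top

theorem continuous_opNorm :
    Continuous fun A : Fin n → Fin n → ℝ => opNorm (Matrix.of A) := by
  have : Continuous fun A : Fin n → Fin n → ℝ =>
      Matrix.toEuclideanCLM (n := Fin n) (𝕜 := ℝ) (Matrix.of A) := by
    let L : (Fin n → Fin n → ℝ) →ₗ[ℝ] (E →L[ℝ] E) :=
      { toFun := fun A => Matrix.toEuclideanCLM (n := Fin n) (𝕜 := ℝ) (Matrix.of A)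
        map_add' := fun A B => by rw [← map_add]; rfl
        map_smul' := fun c A => by rw [RingHom.id_apply, ← map_smul]; rfl }
    exact L.continuous_of_finiteDimensional
  exact this.norm

theorem continuous_det : Continuous fun A : Fin n → Fin n → ℝ => (Matrix.of A).det :=
  Continuous.matrix_det continuous_id

theorem measurable_matrixDilatation :
    Measurable fun A : Fin n → Fin n → ℝ => matrixDilatation (Matrix.of A) := by
  unfold matrixDilatation
  refine Measurable.ite ?_ ?_ (Measurable.ite ?_ measurable_const measurable_const)
  · exact (isOpen_ne_fun continuous_det continuous_const).measurableSet
  · exact ((continuous_opNorm.measurable.pow_const n).div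
      continuous_det.abs.measurable).ennreal_ofReal
  · exact measurableSet_singleton (0 : Fin n → Fin n → ℝ)

end MatrixDilatation

/-! ### The distortion inequality and measurability of the dilatation. -/

section DilatationP

theorem exponent_pos (hn : 2 ≤ n) : 0 < 1 / ((n : ℝ) - 1) := by
  have : (2 : ℝ) ≤ n := by exact_mod_cast hn
  apply one_div_pos.2
  linarith

theorem hasPartials_of_dilatationP_ne_top (hn : 2 ≤ n) {f : E → E} {x : E}
    (h : dilatationP f x ≠ ⊤) : HasPartials f x := by
  by_contra hc
  refine h ?_
  rw [dilatationP, outerDilatation, if_neg hc, ENNReal.top_rpow_of_pos (exponent_pos hn)]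

theorem one_le_dilatationP (hn : 2 ≤ n) (f : E → E) (x : E) : 1 ≤ dilatationP f x := by
  refine ENNReal.one_le_rpow ?_ (exponent_pos hn)
  by_cases h : HasPartials f x
  · rw [outerDilatation_eq h]; exact one_le_matrixDilatation _
  · rw [outerDilatation, if_neg h]; exact le_top

theorem rpow_exponent_pow (hn : 2 ≤ n) {a : ℝ} (ha : 0 ≤ a) :
    (a ^ (1 / ((n : ℝ) - 1))) ^ (n - 1) = a := by
  have h : (2 : ℝ) ≤ n := by exact_mod_cast hn
  rw [← Real.rpow_natCast, ← Real.rpow_mul ha, Nat.cast_sub (by omega), Nat.cast_one,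
    one_div_mul_cancel (by linarith), Real.rpow_one]

/-- Multiplied out, the distortion inequality needs no case distinction between a nonzero Jacobian
and a zero matrix. -/
theorem opNorm_pow_le_of_dilatationP_ne_top (hn : 2 ≤ n) {f : E → E} {x : E}
    (h : dilatationP f x ≠ ⊤) :
    opNorm (jacobian f x) ^ n ≤ (dilatationP f x).toReal ^ (n - 1) * |(jacobian f x).det| := by
  have hp := hasPartials_of_dilatationP_ne_top hn h
  have hK := outerDilatation_eq hp
  rw [dilatationP, hK, matrixDilatation] at h ⊢
  by_cases h1 : (jacobian f x).det = 0
  · by_cases h2 : jacobian f x = 0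
    · rw [opNorm_eq_zero.2 h2, zero_pow (by omega), h1]; simp
    · rw [if_neg (not_not.2 h1), if_neg h2, ENNReal.top_rpow_of_pos (exponent_pos hn)] at h
      exact absurd rfl h
  · rw [if_pos h1]
    have h3 : 0 ≤ opNorm (jacobian f x) ^ n / |(jacobian f x).det| :=
      div_nonneg (pow_nonneg (opNorm_nonneg _) _) (abs_nonneg _)
    rw [← ENNReal.toReal_rpow, ENNReal.toReal_ofReal h3, rpow_exponent_pow hn h3,
      div_mul_cancel₀ _ (abs_ne_zero.2 h1)]

/-- Converse of the previous inequality. The bound 1 ≤ H covers a zero Jacobian matrix, where the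
dilatation is 1 by convention. -/
theorem dilatationP_le_ofReal (hn : 2 ≤ n) {f : E → E} {x : E} (hp : HasPartials f x) {H : ℝ}
    (hH : 1 ≤ H) (h : opNorm (jacobian f x) ^ n ≤ H ^ (n - 1) * |(jacobian f x).det|) :
    dilatationP f x ≤ ENNReal.ofReal H := by
  have hq := exponent_pos hn
  have hK : outerDilatation f x ≤ ENNReal.ofReal (H ^ (n - 1)) := by
    rw [outerDilatation_eq hp, matrixDilatation]
    by_cases h1 : (jacobian f x).det = 0
    · rw [h1, abs_zero, mul_zero] at h
      have h2 : jacobian f x = 0 := by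
        rw [← opNorm_eq_zero]
        exact pow_eq_zero_iff (by omega : n ≠ 0) |>.1
          (le_antisymm h (pow_nonneg (opNorm_nonneg _) _))
      rw [if_neg (not_not.2 h1), if_pos h2, ← ENNReal.ofReal_one]
      exact ENNReal.ofReal_le_ofReal (one_le_pow₀ hH)
    · rw [if_pos h1]
      exact ENNReal.ofReal_le_ofReal ((div_le_iff₀ (abs_pos.2 h1)).2 h)
  refine (ENNReal.rpow_le_rpow hK hq.le).trans ?_
  have hn' : (2 : ℝ) ≤ n := by exact_mod_cast hn
  rw [ENNReal.ofReal_rpow_of_nonneg (by positivity) hq.le]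
  refine ENNReal.ofReal_le_ofReal ?_
  rw [← Real.rpow_natCast, ← Real.rpow_mul (by linarith), Nat.cast_sub (by omega), Nat.cast_one,
    mul_one_div_cancel (by linarith), Real.rpow_one]

theorem jacobian_apply {f : E → E} {x : E} (h : HasPartials f x) (k i : Fin n) :
    LineDifferentiableAt ℝ (fun y => f y k) x (e i) ∧
      lineDeriv ℝ (fun y => f y k) x (e i) = jacobian f x k i := by
  have h1 : HasDerivAt (fun t : ℝ => f (x + t • e i)) (lineDeriv ℝ f x (e i)) 0 :=
    (h i).hasLineDerivAt
  have h2 : HasLineDerivAt ℝ (fun y => f y k) (lineDeriv ℝ f x (e i) k) x (e i) :=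
    ((EuclideanSpace.proj k : E →L[ℝ] ℝ).hasFDerivAt.comp_hasDerivAt 0 h1)
  exact ⟨h2.lineDifferentiableAt, h2.lineDeriv⟩

theorem IsWeakPartial.congr {D : Set E} {i : Fin n} {u v w : E → ℝ}
    (h : IsWeakPartial D i u v) (hvw : ∀ᵐ x ∂volume.restrict D, v x = w x) :
    IsWeakPartial D i u w := by
  refine ⟨h.locallyIntegrable_fun, ?_, fun φ h1 h2 h3 => ?_⟩
  · exact h.locallyIntegrable_deriv.congr hvw
  · rw [h.integral_eq φ h1 h2 h3]
    congr 1
    refine integral_congr_ae ?_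
    filter_upwards [hvw] with x hx
    rw [hx]

/-- This transfers measurability, local integrability and integration by parts to the pointwise
Jacobian matrix that defines the dilatation. -/
theorem MemW11Loc.isWeakPartial_jacobian {D : Set E} (hD : IsOpen D) {f : E → E}
    (h : MemW11Loc D f) (hp : ∀ᵐ x ∂volume.restrict D, HasPartials f x) (k i : Fin n) :
    IsWeakPartial D i (fun x => f x k) fun x => jacobian f x k i := by
  obtain ⟨v, hv⟩ := (h k).2 i
  refine hv.congr ?_
  have h1 := hv.ae_eq_lineDeriv hD (hp.mono fun x hx => (jacobian_apply hx k i).1)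
  filter_upwards [h1, hp] with x hx hx'
  rw [← hx, (jacobian_apply hx' k i).2]

theorem aemeasurable_jacobian {D : Set E} (hD : IsOpen D) {f : E → E}
    (h : MemW11Loc D f) (hp : ∀ᵐ x ∂volume.restrict D, HasPartials f x) :
    AEMeasurable (fun x (k i : Fin n) => jacobian f x k i) (volume.restrict D) := by
  refine aemeasurable_pi_iff.2 fun k => aemeasurable_pi_iff.2 fun i => ?_
  exact (h.isWeakPartial_jacobian hD hp k i).locallyIntegrable_deriv.aestronglyMeasurable.aemeasurable

theorem aemeasurable_dilatationP {D : Set E} (hD : IsOpen D) {f : E → E}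
    (h : MemW11Loc D f) (hp : ∀ᵐ x ∂volume.restrict D, HasPartials f x) :
    AEMeasurable (dilatationP f) (volume.restrict D) := by
  have h1 := (measurable_matrixDilatation.comp_aemeasurable
    (aemeasurable_jacobian hD h hp)).pow_const (1 / ((n : ℝ) - 1))
  refine h1.congr ?_
  filter_upwards [hp] with x hx
  rw [dilatationP, outerDilatation_eq hx]
  rfl

end DilatationP

/-! ### Integrals against compactly supported functions. -/

section Pairing

theorem integrableOn_mul_of_tsupport_subset {D : Set E} {g φ : E → ℝ}
    (hg : LocallyIntegrableOn g D) (hφ : MemLp φ ⊤ volume) (hφc : HasCompactSupport φ)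
    (hφD : tsupport φ ⊆ D) : IntegrableOn (fun x => g x * φ x) D := by
  have h1 : IntegrableOn g (tsupport φ) := hg.integrableOn_compact_subset hφD hφc
  obtain ⟨C, hC⟩ : ∃ C : ℝ, ∀ᵐ x, ‖φ x‖ ≤ C := by
    have h2 := hφ.2.ne
    rw [eLpNorm_exponent_top] at h2
    refine ⟨(eLpNormEssSup φ volume).toReal, ?_⟩
    filter_upwards [ae_le_eLpNormEssSup (f := φ) (μ := volume)] with x hx
    rw [← toReal_enorm]
    exact ENNReal.toReal_mono h2 hx
  have h2 : IntegrableOn (fun x => g x * φ x) (tsupport φ) :=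
    Integrable.mul_bdd (c := C) h1 hφ.1.restrict (ae_restrict_of_ae hC)
  refine ((integrableOn_iff_integrable_of_support_subset ?_).1 h2).integrableOn
  intro x hx
  by_contra hc
  exact hx (by simp [image_eq_zero_of_notMem_tsupport hc])

theorem memLp_top_of_continuous {φ : E → ℝ} (hφ : Continuous φ) (hφc : HasCompactSupport φ) :
    MemLp φ ⊤ volume := hφ.memLp_top_of_hasCompactSupport hφc volume

theorem tendsto_setIntegral_mul_of_tendstoUniformlyOn {D : Set E} {u : ℕ → E → ℝ} {v φ : E → ℝ}
    (hu : ∀ j, LocallyIntegrableOn (u j) D) (hv : LocallyIntegrableOn v D)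
    (hφ : Continuous φ) (hφc : HasCompactSupport φ) (hφD : tsupport φ ⊆ D)
    (huv : TendstoUniformlyOn u v atTop (tsupport φ)) :
    Tendsto (fun j => ∫ x in D, u j x * φ x) atTop (𝓝 (∫ x in D, v x * φ x)) := by
  have hφm := memLp_top_of_continuous hφ hφc
  refine tendsto_integral_filter_of_dominated_convergence (fun x => ‖v x * φ x‖ + ‖φ x‖)
    (Eventually.of_forall fun j => (integrableOn_mul_of_tsupport_subset (hu j) hφm hφc hφD).1)
    ?_ ?_ ?_
  · filter_upwards [Metric.tendstoUniformlyOn_iff.1 huv 1 one_pos] with j hj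
    refine Eventually.of_forall fun x => ?_
    by_cases hx : x ∈ tsupport φ
    · have h1 := hj x hx
      rw [dist_comm, Real.dist_eq] at h1
      rw [norm_mul, norm_mul, ← add_one_mul]
      refine mul_le_mul_of_nonneg_right ?_ (norm_nonneg _)
      have h2 := norm_add_le (v x) (u j x - v x)
      rw [add_sub_cancel, Real.norm_eq_abs (u j x - v x)] at h2
      linarith
    · simp [image_eq_zero_of_notMem_tsupport hx]
  · exact (integrableOn_mul_of_tsupport_subset hv hφm hφc hφD).norm.add
      (hφ.integrable_of_hasCompactSupport hφc).norm.integrableOn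
  · refine Eventually.of_forall fun x => ?_
    by_cases hx : x ∈ tsupport φ
    · exact (huv.tendsto_at hx).mul_const _
    · simp [image_eq_zero_of_notMem_tsupport hx]

theorem sum_smul_e (h : E) : ∑ i, h i • e i = h := by
  ext k; simp [Finset.sum_apply, Pi.single_apply]

/-- Integration by parts against a test function, in arbitrary directions. -/
theorem setIntegral_inner_mul_fderiv {D : Set E} {f : E → E}
    (hw : ∀ k i, IsWeakPartial D i (fun x => f x k) fun x => jacobian f x k i)
    {φ : E → ℝ} (hφ : ContDiff ℝ ∞ φ) (hφc : HasCompactSupport φ) (hφD : tsupport φ ⊆ D)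
    (a h : E) :
    ∫ x in D, inner ℝ a (f x) * fderiv ℝ φ x h =
      -∫ x in D, inner ℝ a (jacobianCLM f x h) * φ x := by
  have hφm := memLp_top_of_continuous hφ.continuous hφc
  have hd : ∀ i : Fin n, Continuous fun x => fderiv ℝ φ x (e i) := fun i =>
    (hφ.continuous_fderiv (by simp)).clm_apply continuous_const
  have hdc : ∀ i : Fin n, HasCompactSupport fun x => fderiv ℝ φ x (e i) := fun i =>
    hφc.fderiv_apply ℝ (e i)
  have hdD : ∀ i : Fin n, tsupport (fun x => fderiv ℝ φ x (e i)) ⊆ D := fun i =>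
    (tsupport_fderiv_apply_subset ℝ (e i)).trans hφD
  have e1 : ∀ x, inner ℝ a (f x) * fderiv ℝ φ x h =
      ∑ k, ∑ i, (a k * h i) * (f x k * lineDeriv ℝ φ x (e i)) := by
    intro x
    have h1 : fderiv ℝ φ x h = ∑ i, h i * fderiv ℝ φ x (e i) := by
      conv_lhs => rw [← sum_smul_e h]
      simp [map_sum]
    rw [h1, PiLp.inner_apply, Finset.sum_mul_sum]
    refine Finset.sum_congr rfl fun k _ => Finset.sum_congr rfl fun i _ => ?_
    rw [(hφ.differentiable (by simp) x).lineDeriv_eq_fderiv]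
    simp
    ring
  have e2 : ∀ x, inner ℝ a (jacobianCLM f x h) * φ x =
      ∑ k, ∑ i, (a k * h i) * (jacobian f x k i * φ x) := by
    intro x
    rw [PiLp.inner_apply, Finset.sum_mul]
    refine Finset.sum_congr rfl fun k _ => ?_
    simp only [jacobianCLM, Matrix.ofLp_toEuclideanCLM, Matrix.mulVec, dotProduct]
    simp only [RCLike.inner_apply, conj_trivial, Finset.sum_mul]
    refine Finset.sum_congr rfl fun i _ => ?_
    ring
  simp only [e1, e2]
  rw [integral_finsetSum, integral_finsetSum, ← Finset.sum_neg_distrib]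
  · refine Finset.sum_congr rfl fun k _ => ?_
    rw [integral_finsetSum, integral_finsetSum, ← Finset.sum_neg_distrib]
    · refine Finset.sum_congr rfl fun i _ => ?_
      rw [integral_const_mul, integral_const_mul, (hw k i).integral_eq φ hφ hφc hφD]
      ring
    · intro i _
      exact (integrableOn_mul_of_tsupport_subset (hw k i).locallyIntegrable_deriv hφm hφc
        hφD).const_mul _
    · intro i _
      simp only [(hφ.differentiable (by simp) _).lineDeriv_eq_fderiv]
      exact (integrableOn_mul_of_tsupport_subset (hw k i).locallyIntegrable_fun
        (memLp_top_of_continuous (hd i) (hdc i)) (hdc i) (hdD i)).const_mul _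
  · intro k _
    refine integrable_finsetSum _ fun i _ => ?_
    exact (integrableOn_mul_of_tsupport_subset (hw k i).locallyIntegrable_deriv hφm hφc
      hφD).const_mul _
  · intro k _
    refine integrable_finsetSum _ fun i _ => ?_
    simp only [(hφ.differentiable (by simp) _).lineDeriv_eq_fderiv]
    exact (integrableOn_mul_of_tsupport_subset (hw k i).locallyIntegrable_fun
      (memLp_top_of_continuous (hd i) (hdc i)) (hdc i) (hdD i)).const_mul _

end Pairing

/-! ### Young's inequality as a linear form of the distortion inequality. -/

section Young

/-- Weighted AM-GM with weights (n-1)/n and 1/n for t p and t^(1-n) J; t cancels in the geometric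
mean. The bound is linear in p and J, so it survives integration. -/
theorem young_of_pow_le (hn : 2 ≤ n) {a p J t : ℝ} (ha : 0 ≤ a) (hp : 0 ≤ p) (hJ : 0 ≤ J)
    (ht : 0 < t) (h : a ^ n ≤ p ^ (n - 1) * J) :
    a ≤ (((n : ℝ) - 1) / n * t) * p + (1 / n * (t ^ (n - 1))⁻¹) * J := by
  have hn0 : (2 : ℝ) ≤ n := by exact_mod_cast hn
  have hn1 : (0 : ℝ) < n := by linarith
  have hx : 0 ≤ t * p := by positivity
  have hy : 0 ≤ (t ^ (n - 1))⁻¹ * J := by positivity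
  have key := Real.geom_mean_le_arith_mean2_weighted (w₁ := ((n : ℝ) - 1) / n) (w₂ := 1 / n)
    (div_nonneg (by linarith) hn1.le) (by positivity) hx hy (by field_simp; ring)
  have hpow : ((t * p) ^ (((n : ℝ) - 1) / n) * ((t ^ (n - 1))⁻¹ * J) ^ (1 / (n : ℝ))) ^ n =
      p ^ (n - 1) * J := by
    rw [mul_pow, ← Real.rpow_natCast, ← Real.rpow_mul hx, div_mul_cancel₀ _ hn1.ne',
      ← Real.rpow_natCast _ n, ← Real.rpow_mul hy, one_div_mul_cancel hn1.ne', Real.rpow_one]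
    have : ((n : ℝ) - 1) = ((n - 1 : ℕ) : ℝ) := by rw [Nat.cast_sub (by omega), Nat.cast_one]
    rw [this, Real.rpow_natCast, mul_pow]
    field_simp
  have h2 : a ≤ (t * p) ^ (((n : ℝ) - 1) / n) * ((t ^ (n - 1))⁻¹ * J) ^ (1 / (n : ℝ)) := by
    rw [← hpow] at h
    exact (pow_le_pow_iff_left₀ ha (by positivity) (by omega)).1 h
  linarith

/-- The minimizing t is (J/p)^(1/n), which gives equality in AM-GM; if J = 0 one lets t tend to 0.
-/
theorem pow_le_of_forall_young (hn : 2 ≤ n) {a p J : ℝ} (ha : 0 ≤ a) (hp : 0 < p) (hJ : 0 ≤ J)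
    (h : ∀ t > 0, a ≤ (((n : ℝ) - 1) / n * t) * p + (1 / n * (t ^ (n - 1))⁻¹) * J) :
    a ^ n ≤ p ^ (n - 1) * J := by
  have hn0 : (2 : ℝ) ≤ n := by exact_mod_cast hn
  have hn1 : (0 : ℝ) < n := by linarith
  rcases hJ.eq_or_lt with rfl | hJ
  · have h0 : a ≤ 0 := by
      refine le_of_forall_pos_le_add fun ε hε => ?_
      have h1 := h (ε / p) (by positivity)
      rw [mul_zero, add_zero, mul_assoc, div_mul_cancel₀ _ hp.ne'] at h1
      have h2 : ((n : ℝ) - 1) / n ≤ 1 := (div_le_one hn1).2 (by linarith)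
      nlinarith
    rw [le_antisymm h0 ha, zero_pow (by omega), mul_zero]
  · set s := (J / p) ^ (1 / (n : ℝ)) with hs
    have hs0 : 0 < s := Real.rpow_pos_of_pos (by positivity) _
    have hsn : s ^ n = J / p := by
      rw [hs, ← Real.rpow_natCast, ← Real.rpow_mul (by positivity), one_div_mul_cancel hn1.ne',
        Real.rpow_one]
    have hJs : J = s ^ n * p := by rw [hsn, div_mul_cancel₀ _ hp.ne']
    have hsplit : s ^ n = s ^ (n - 1) * s := by
      rw [← pow_succ]; congr 1; omega
    have hpsplit : p ^ n = p ^ (n - 1) * p := by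
      rw [← pow_succ]; congr 1; omega
    have h1 := h s hs0
    have h2 : (((n : ℝ) - 1) / n * s) * p + (1 / n * (s ^ (n - 1))⁻¹) * J = s * p := by
      rw [hJs, hsplit]
      field_simp
      ring
    rw [h2] at h1
    calc a ^ n ≤ (s * p) ^ n := pow_le_pow_left₀ ha h1 n
      _ = p ^ (n - 1) * J := by rw [mul_pow, hJs, hpsplit]; ring

end Young

/-! ### Images of small balls and averages over them. -/

section Blowup

theorem closedBall_subset_eventually {D : Set E} (hD : IsOpen D) {x₀ : E} (hx₀ : x₀ ∈ D) :
    ∀ᶠ r : ℝ in 𝓝[>] 0, Metric.closedBall x₀ r ⊆ D := by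
  obtain ⟨R, hR, hRD⟩ := Metric.nhds_basis_closedBall.mem_iff.1 (hD.mem_nhds hx₀)
  filter_upwards [Ioo_mem_nhdsGT hR] with r hr
  exact (Metric.closedBall_subset_closedBall hr.2.le).trans hRD

theorem tendstoUniformlyOn_of_isCompact {D K : Set E} {F : ℕ → E → E} {f : E → E}
    (h : TendstoLocallyUniformlyOn F f atTop D) (hK : IsCompact K) (hKD : K ⊆ D) :
    TendstoUniformlyOn F f atTop K :=
  (tendstoLocallyUniformlyOn_iff_tendstoUniformlyOn_of_compact hK).1 (h.mono hKD)

theorem eventually_norm_sub_sub_le {f : E → E} {x₀ : E} (hf : DifferentiableAt ℝ f x₀) {ε : ℝ}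
    (hε : 0 < ε) : ∀ᶠ r : ℝ in 𝓝[>] 0, ∀ x ∈ Metric.closedBall x₀ r,
      ‖f x - f x₀ - fderiv ℝ f x₀ (x - x₀)‖ ≤ ε * r := by
  have h1 := (hasFDerivAt_iff_isLittleO.1 hf.hasFDerivAt).def hε
  obtain ⟨R, hR, hR'⟩ := Metric.eventually_nhds_iff_ball.1 h1
  filter_upwards [Ioo_mem_nhdsGT hR] with r hr x hx
  have h2 := Metric.mem_closedBall.1 hx
  refine (hR' x (Metric.mem_ball.2 (h2.trans_lt hr.2))).trans ?_
  rw [← dist_eq_norm]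
  exact mul_le_mul_of_nonneg_left h2 hε.le

open scoped Pointwise in
/-- Images of small balls under maps uniformly close to a differentiable map. -/
theorem eventually_volume_image_closedBall_le {D : Set E} (hD : IsOpen D) {F : ℕ → E → E}
    {f : E → E} (hF : TendstoLocallyUniformlyOn F f atTop D) {x₀ : E} (hx₀ : x₀ ∈ D)
    (hf : DifferentiableAt ℝ f x₀) {m : ℝ} (hm : |(fderiv ℝ f x₀).det| < m) :
    ∀ᶠ r : ℝ in 𝓝[>] 0, ∀ᶠ j in atTop, volume (F j '' Metric.closedBall x₀ r) ≤
      ENNReal.ofReal m * volume (Metric.closedBall x₀ r) := by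
  set A := fderiv ℝ f x₀ with hA
  have hcomp : IsCompact (A '' Metric.closedBall (0 : E) 1) :=
    (isCompact_closedBall _ _).image A.continuous
  have hβ0 : volume (Metric.closedBall (0 : E) 1) ≠ 0 :=
    (Metric.measure_closedBall_pos _ _ one_pos).ne'
  have hβ1 : volume (Metric.closedBall (0 : E) 1) ≠ ⊤ := measure_closedBall_lt_top.ne
  have hvol : volume (A '' Metric.closedBall (0 : E) 1) <
      ENNReal.ofReal m * volume (Metric.closedBall (0 : E) 1) := by
    rw [Measure.addHaar_image_continuousLinearMap]
    rw [ENNReal.mul_lt_mul_iff_left hβ0 hβ1]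
    exact (ENNReal.ofReal_lt_ofReal_iff ((abs_nonneg _).trans_lt hm)).2 hm
  -- Closed thickenings of a compact set shrink to it in volume, so the strict inequality leaves
  -- room for some ε.
  obtain ⟨ε, hεv, hε⟩ : ∃ ε : ℝ, volume (Metric.cthickening ε (A '' Metric.closedBall (0 : E) 1)) <
      ENNReal.ofReal m * volume (Metric.closedBall (0 : E) 1) ∧ 0 < ε :=
    ((((tendsto_measure_cthickening_of_isCompact (μ := volume) hcomp).mono_left
      (nhdsWithin_le_nhds (s := Set.Ioi 0))).eventually_lt_const hvol).and
      self_mem_nhdsWithin).exists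
  filter_upwards [closedBall_subset_eventually hD hx₀,
    eventually_norm_sub_sub_le hf (half_pos hε), self_mem_nhdsWithin] with r hrD hr hr0
  have hr0 : 0 < r := hr0
  have hunif := tendstoUniformlyOn_of_isCompact hF (isCompact_closedBall x₀ r) hrD
  filter_upwards [Metric.tendstoUniformlyOn_iff.1 hunif (ε / 2 * r) (by positivity)] with j hj
  -- After rescaling by 1/r, half of ε absorbs the error of differentiability and half the distance
  -- from F_j to f.
  have hsub : F j '' Metric.closedBall x₀ r ⊆
      (fun y => y + -(f x₀)) ⁻¹' (r • Metric.cthickening ε (A '' Metric.closedBall (0 : E) 1)) := by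
    rintro _ ⟨x, hx, rfl⟩
    rw [Set.mem_preimage, Set.mem_smul_set_iff_inv_smul_mem₀ hr0.ne']
    refine Metric.mem_cthickening_of_dist_le _ (A (r⁻¹ • (x - x₀))) _ _ ⟨_, ?_, rfl⟩ ?_
    · rw [mem_closedBall_zero_iff, norm_smul, norm_inv, Real.norm_of_nonneg hr0.le,
        inv_mul_le_iff₀ hr0, mul_one, ← dist_eq_norm]
      exact hx
    · rw [map_smul, dist_eq_norm, ← smul_sub, norm_smul, norm_inv, Real.norm_of_nonneg hr0.le,
        inv_mul_le_iff₀ hr0]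
      have h1 := hr x hx
      have h2 := (hj x hx).le
      rw [dist_comm, dist_eq_norm] at h2
      have h3 : F j x + -f x₀ - A (x - x₀) = (F j x - f x) + (f x - f x₀ - A (x - x₀)) := by abel
      rw [h3]
      refine (norm_add_le _ _).trans ?_
      linarith
  refine (measure_mono hsub).trans ?_
  rw [measure_preimage_add_right, Measure.addHaar_smul, Measure.addHaar_closedBall' _ _ hr0.le,
    finrank_euclideanSpace_fin, abs_of_pos (by positivity), ← mul_assoc,
    mul_comm (ENNReal.ofReal m), mul_assoc]
  gcongr

theorem limsup_lintegral_le_of_aemeasurable {α : Type*} [MeasurableSpace α] {μ : Measure α}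
    {g : ℕ → α → ℝ≥0∞} (b : α → ℝ≥0∞) (hg : ∀ j, AEMeasurable (g j) μ)
    (hb : ∀ j, g j ≤ᵐ[μ] b) (hfin : ∫⁻ x, b x ∂μ ≠ ⊤) :
    limsup (fun j => ∫⁻ x, g j x ∂μ) atTop ≤ ∫⁻ x, limsup (fun j => g j x) atTop ∂μ := by
  have h1 : ∀ᵐ x ∂μ, ∀ j, g j x = (hg j).mk (g j) x := ae_all_iff.2 fun j => (hg j).ae_eq_mk
  have h2 := limsup_lintegral_le (μ := μ) (f := fun j => (hg j).mk (g j)) b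
    (fun j => (hg j).measurable_mk) (fun j => by
      filter_upwards [h1, hb j] with x hx hx'
      rw [← hx j]; exact hx') hfin
  have h3 : ∀ j, ∫⁻ x, (hg j).mk (g j) x ∂μ = ∫⁻ x, g j x ∂μ := fun j =>
    lintegral_congr_ae (hg j).ae_eq_mk.symm
  simp only [h3] at h2
  refine h2.trans_eq (lintegral_congr_ae ?_)
  filter_upwards [h1] with x hx
  simp only [hx]

theorem aemeasurable_limsup {α : Type*} [MeasurableSpace α] {μ : Measure α}
    {g : ℕ → α → ℝ≥0∞} (hg : ∀ j, AEMeasurable (g j) μ) :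
    AEMeasurable (fun x => limsup (fun j => g j x) atTop) μ := by
  refine ⟨fun x => limsup (fun j => (hg j).mk (g j) x) atTop,
    Measurable.limsup fun j => (hg j).measurable_mk, ?_⟩
  filter_upwards [ae_all_iff.2 fun j => (hg j).ae_eq_mk] with x hx
  simp only [hx]

/-- Upper semicontinuity of averages over small balls along a dominated sequence. -/
theorem ae_eventually_lintegral_closedBall_le {D : Set E} (hD : IsOpen D) {Q : ℕ → E → ℝ≥0∞}
    {P : E → ℝ} (hP : LocallyIntegrableOn P D) (hQ : ∀ j, AEMeasurable (Q j) (volume.restrict D))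
    (hQP : ∀ j, ∀ᵐ x ∂volume.restrict D, Q j x ≤ ENNReal.ofReal (P x)) :
    ∀ᵐ x₀ ∂volume.restrict D, ∀ m : ℝ≥0∞, limsup (fun j => Q j x₀) atTop < m →
      ∀ᶠ r : ℝ in 𝓝[>] 0, ∀ᶠ j in atTop, ∫⁻ x in Metric.closedBall x₀ r, Q j x ≤
        m * volume (Metric.closedBall x₀ r) := by
  refine ae_restrict_of_locally hD fun y hy => ?_
  obtain ⟨R, hR, hRD⟩ := Metric.nhds_basis_closedBall.mem_iff.1 (hD.mem_nhds hy)
  refine ⟨R, hR, ?_⟩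
  set B := Metric.closedBall y R with hB
  have hBm : MeasurableSet B := Metric.isClosed_closedBall.measurableSet
  have hPB : ∫⁻ x in B, ENNReal.ofReal (P x) ≠ ⊤ := by
    have h1 : IntegrableOn P B := hP.integrableOn_compact_subset hRD (isCompact_closedBall _ _)
    exact ((lintegral_mono fun x => Real.ofReal_le_enorm (P x)).trans_lt h1.2).ne
  -- Cutting off to B makes the limsup globally integrable, as it is dominated by P there, so
  -- Lebesgue differentiation applies.
  set H : E → ℝ≥0∞ := B.indicator fun x => limsup (fun j => Q j x) atTop with hH
  have hlim : AEMeasurable (fun x => limsup (fun j => Q j x) atTop) (volume.restrict B) :=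
    aemeasurable_limsup fun j => (hQ j).mono_measure (Measure.restrict_mono hRD le_rfl)
  have hHm : AEMeasurable H volume := (aemeasurable_indicator_iff hBm).2 hlim
  have hQP' : ∀ᵐ x ∂volume.restrict B, ∀ j, Q j x ≤ ENNReal.ofReal (P x) :=
    ae_all_iff.2 fun j => ae_mono (Measure.restrict_mono hRD le_rfl) (hQP j)
  have hHfin : ∫⁻ x, H x ≠ ⊤ := by
    rw [hH, lintegral_indicator hBm]
    refine ((lintegral_mono_ae ?_).trans_lt hPB.lt_top).ne
    filter_upwards [hQP'] with x hx
    exact limsup_le_of_le (h := Eventually.of_forall hx)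
  have hd := VitaliFamily.ae_tendsto_lintegral_div (Besicovitch.vitaliFamily (volume : Measure E))
    hHm hHfin
  filter_upwards [ae_restrict_of_ae hd, ae_restrict_mem Metric.isOpen_ball.measurableSet] with
    x hx hxB m hm
  have hx2 := hx.comp (Besicovitch.tendsto_filterAt (volume : Measure E) x)
  have hHx : H x = limsup (fun j => Q j x) atTop :=
    Set.indicator_of_mem (Metric.ball_subset_closedBall hxB) _
  rw [hHx] at hx2
  filter_upwards [hx2.eventually_lt_const hm, self_mem_nhdsWithin,
    closedBall_subset_eventually Metric.isOpen_ball hxB] with r hr hr0 hrB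
  have hr0 : 0 < r := hr0
  have hrB' : Metric.closedBall x r ⊆ B := hrB.trans Metric.ball_subset_closedBall
  simp only [Function.comp] at hr
  rw [ENNReal.div_lt_iff (Or.inl (Metric.measure_closedBall_pos _ _ hr0).ne')
    (Or.inl measure_closedBall_lt_top.ne)] at hr
  have h5 : ∫⁻ z in Metric.closedBall x r, H z =
      ∫⁻ z in Metric.closedBall x r, limsup (fun j => Q j z) atTop := by
    refine setLIntegral_congr_fun Metric.isClosed_closedBall.measurableSet fun z hz => ?_
    exact Set.indicator_of_mem (hrB' hz) _
  rw [h5] at hr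
  -- Reverse Fatou at a fixed radius: the average of the limsup controls the integrals for large j.
  have h6 := limsup_lintegral_le_of_aemeasurable (μ := volume.restrict (Metric.closedBall x r))
    (g := Q) (fun x => ENNReal.ofReal (P x))
    (fun j => (hQ j).mono_measure (Measure.restrict_mono (hrB'.trans hRD) le_rfl))
    (fun j => ae_mono (Measure.restrict_mono (hrB'.trans hRD) le_rfl) (hQP j))
    ((lintegral_mono_set hrB').trans_lt hPB.lt_top).ne
  exact (eventually_lt_of_limsup_lt (h6.trans_lt hr)).mono fun j hj => hj.le

end Blowup

/-! ### Semicontinuity of the dilatation. -/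

section Semicontinuity

theorem jacobianCLM_eq_fderiv {f : E → E} {x : E} (hf : DifferentiableAt ℝ f x) :
    jacobianCLM f x = fderiv ℝ f x :=
  clm_ext_e fun i => by rw [jacobianCLM_apply_e, hf.lineDeriv_eq_fderiv]

/-- Integration by parts leaves an integrand bounded by the operator norm of the Jacobian matrix on
B, to which Young's inequality applies pointwise. -/
theorem enorm_setIntegral_inner_mul_fderiv_le (hn : 2 ≤ n) {D B : Set E}
    (hB : MeasurableSet B) (hBD : B ⊆ D) {f : E → E}
    (hw : ∀ k i, IsWeakPartial D i (fun x => f x k) fun x => jacobian f x k i)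
    (hm : AEMeasurable (dilatationP f) (volume.restrict D))
    (hfin : ∀ᵐ x ∂volume.restrict D, dilatationP f x ≠ ⊤)
    {φ : E → ℝ} (hφ : ContDiff ℝ ∞ φ) (hφc : HasCompactSupport φ) (hφB : tsupport φ ⊆ B)
    (hφ1 : ∀ x, |φ x| ≤ 1) {a h : E} (ha : ‖a‖ ≤ 1) (hh : ‖h‖ ≤ 1) {t : ℝ} (ht : 0 < t) :
    ‖∫ x in D, inner ℝ a (f x) * fderiv ℝ φ x h‖ₑ ≤
      ENNReal.ofReal (((n : ℝ) - 1) / n * t) * (∫⁻ x in B, dilatationP f x) +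
      ENNReal.ofReal (1 / n * (t ^ (n - 1))⁻¹) *
        ∫⁻ x in B, ENNReal.ofReal |(jacobian f x).det| := by
  have hn0 : (2 : ℝ) ≤ n := by exact_mod_cast hn
  have hc1 : 0 ≤ ((n : ℝ) - 1) / n * t :=
    mul_nonneg (div_nonneg (by linarith) (by linarith)) ht.le
  have hc2 : 0 ≤ 1 / n * (t ^ (n - 1))⁻¹ := by positivity
  set c₁ := ((n : ℝ) - 1) / n * t
  set c₂ := 1 / n * (t ^ (n - 1))⁻¹
  rw [setIntegral_inner_mul_fderiv hw hφ hφc (hφB.trans hBD), enorm_neg]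
  refine (enorm_integral_le_lintegral_enorm _).trans ?_
  set g : E → ℝ≥0∞ := fun x => ENNReal.ofReal c₁ * dilatationP f x +
    ENNReal.ofReal c₂ * ENNReal.ofReal |(jacobian f x).det| with hg
  have h1 : ∀ᵐ x ∂volume.restrict D, ‖inner ℝ a (jacobianCLM f x h) * φ x‖ₑ ≤ B.indicator g x := by
    filter_upwards [hfin] with x hx
    by_cases hxB : x ∈ B
    · rw [Set.indicator_of_mem hxB, hg]
      have h2 := young_of_pow_le hn (opNorm_nonneg _) ENNReal.toReal_nonneg (abs_nonneg _) ht
        (opNorm_pow_le_of_dilatationP_ne_top hn hx)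
      have h3 : |inner ℝ a (jacobianCLM f x h) * φ x| ≤ opNorm (jacobian f x) := by
        rw [abs_mul]
        have h4 : |inner ℝ a (jacobianCLM f x h)| ≤ opNorm (jacobian f x) := by
          refine (abs_real_inner_le_norm _ _).trans ?_
          have h5 := (jacobianCLM f x).le_opNorm h
          have h6 : ‖jacobianCLM f x‖ = opNorm (jacobian f x) := rfl
          rw [h6] at h5
          have h7 := opNorm_nonneg (jacobian f x)
          nlinarith [norm_nonneg a, norm_nonneg h, norm_nonneg (jacobianCLM f x h)]
        nlinarith [hφ1 x, abs_nonneg (φ x), abs_nonneg (inner ℝ a (jacobianCLM f x h)),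
          opNorm_nonneg (jacobian f x)]
      rw [Real.enorm_eq_ofReal_abs]
      refine (ENNReal.ofReal_le_ofReal (h3.trans h2)).trans_eq ?_
      rw [ENNReal.ofReal_add (mul_nonneg hc1 ENNReal.toReal_nonneg)
        (mul_nonneg hc2 (abs_nonneg _)), ENNReal.ofReal_mul hc1, ENNReal.ofReal_mul hc2,
        ENNReal.ofReal_toReal hx]
    · have h2 : φ x = 0 := image_eq_zero_of_notMem_tsupport fun hc => hxB (hφB hc)
      simp [h2]
  refine (lintegral_mono_ae h1).trans ?_
  rw [lintegral_indicator hB, Measure.restrict_restrict hB, Set.inter_eq_left.2 hBD, hg,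
    lintegral_add_left' ((hm.mono_measure (Measure.restrict_mono hBD le_rfl)).const_mul _),
    lintegral_const_mul' _ _ ENNReal.ofReal_ne_top, lintegral_const_mul' _ _ ENNReal.ofReal_ne_top]

/-- The bump function `χ` transported to the ball of centre `x₀` and radius `r`. -/
noncomputable def scaledBump (χ : ContDiffBump (0 : E)) (x₀ : E) (r : ℝ) (x : E) : ℝ :=
  χ (r⁻¹ • (x - x₀))

theorem contDiff_scaledBump (χ : ContDiffBump (0 : E)) (x₀ : E) (r : ℝ) :
    ContDiff ℝ ∞ (scaledBump χ x₀ r) :=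
  χ.contDiff.comp ((contDiff_id.sub contDiff_const).const_smul r⁻¹)

theorem tsupport_scaledBump_subset (χ : ContDiffBump (0 : E)) (hχ : χ.rOut = 1) (x₀ : E) {r : ℝ}
    (hr : 0 < r) : tsupport (scaledBump χ x₀ r) ⊆ Metric.closedBall x₀ r := by
  refine closure_minimal (fun x hx => ?_) Metric.isClosed_closedBall
  have h1 : r⁻¹ • (x - x₀) ∈ Function.support χ := hx
  rw [χ.support_eq, mem_ball_zero_iff, hχ, norm_smul, norm_inv, Real.norm_of_nonneg hr.le,
    inv_mul_lt_iff₀ hr, mul_one] at h1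
  rw [Metric.mem_closedBall, dist_eq_norm]
  exact h1.le

theorem hasCompactSupport_scaledBump (χ : ContDiffBump (0 : E)) (hχ : χ.rOut = 1) (x₀ : E) {r : ℝ}
    (hr : 0 < r) : HasCompactSupport (scaledBump χ x₀ r) :=
  (isCompact_closedBall x₀ r).of_isClosed_subset (isClosed_tsupport _)
    (tsupport_scaledBump_subset χ hχ x₀ hr)

theorem fderiv_scaledBump (χ : ContDiffBump (0 : E)) (x₀ : E) (r : ℝ) (x h : E) :
    fderiv ℝ (scaledBump χ x₀ r) x h = r⁻¹ * fderiv ℝ χ (r⁻¹ • (x - x₀)) h := by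
  have h1 : HasFDerivAt (fun x : E => r⁻¹ • (x - x₀)) (r⁻¹ • ContinuousLinearMap.id ℝ E) x :=
    ((hasFDerivAt_id x).sub_const x₀).const_smul r⁻¹
  have h2 : HasFDerivAt χ (fderiv ℝ χ (r⁻¹ • (x - x₀))) (r⁻¹ • (x - x₀)) :=
    ((χ.contDiff (n := 1)).differentiable (by simp) _).hasFDerivAt
  have h3 := (h2.comp x h1).fderiv
  have h4 : (χ ∘ fun x : E => r⁻¹ • (x - x₀)) = scaledBump χ x₀ r := rfl
  rw [h4] at h3
  rw [h3]
  simp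

theorem integral_comp_rescale (g : E → ℝ) (x₀ : E) {r : ℝ} (hr : 0 < r) :
    ∫ x, g (r⁻¹ • (x - x₀)) = r ^ n * ∫ x, g x := by
  rw [integral_sub_right_eq_self (fun x => g (r⁻¹ • x)) x₀, Measure.integral_comp_inv_smul,
    finrank_euclideanSpace_fin, abs_of_pos (by positivity), smul_eq_mul]

/-- For the affine approximation of f, integration by parts is exact and gives the main term. The
error is at most ε r times the L¹ norm of a derivative of the scaled bump, which has order r^(n-1),
so both terms scale as r^n. -/
theorem le_abs_setIntegral_inner_mul_fderiv_scaledBump {D : Set E} (hD : IsOpen D) {f : E → E}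
    (hfc : ContinuousOn f D) {x₀ : E} (χ : ContDiffBump (0 : E)) (hχ : χ.rOut = 1) {r ε : ℝ}
    (hr : 0 < r) (hrD : Metric.closedBall x₀ r ⊆ D) (A : E →L[ℝ] E)
    (hA : ∀ x ∈ Metric.closedBall x₀ r, ‖f x - f x₀ - A (x - x₀)‖ ≤ ε * r)
    {a : E} (ha : ‖a‖ ≤ 1) (h : E) :
    (inner ℝ a (A h) * ∫ x, χ x) * r ^ n - (ε * ∫ x, |fderiv ℝ χ x h|) * r ^ n ≤
      |∫ x in D, inner ℝ a (f x) * fderiv ℝ (scaledBump χ x₀ r) x h| := by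
  set φ := scaledBump χ x₀ r with hφdef
  have hφ : ContDiff ℝ ∞ φ := contDiff_scaledBump χ x₀ r
  have hφc : HasCompactSupport φ := hasCompactSupport_scaledBump χ hχ x₀ hr
  have hφB : tsupport φ ⊆ Metric.closedBall x₀ r := tsupport_scaledBump_subset χ hχ x₀ hr
  have hψ : Continuous fun x => fderiv ℝ φ x h :=
    (hφ.continuous_fderiv (by simp)).clm_apply continuous_const
  have hψc : HasCompactSupport fun x => fderiv ℝ φ x h := hφc.fderiv_apply ℝ h
  have hψB : tsupport (fun x => fderiv ℝ φ x h) ⊆ Metric.closedBall x₀ r :=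
    (tsupport_fderiv_apply_subset ℝ h).trans hφB
  have hψ0 : ∀ x ∉ Metric.closedBall x₀ r, fderiv ℝ φ x h = 0 := fun x hx =>
    image_eq_zero_of_notMem_tsupport (f := fun x => fderiv ℝ φ x h) fun hc => hx (hψB hc)
  have hfi : LocallyIntegrableOn (fun x => inner ℝ a (f x)) D :=
    (continuousOn_const.inner hfc).locallyIntegrableOn hD.measurableSet
  have hI1 : Integrable fun x => inner ℝ a (f x) * fderiv ℝ φ x h := by
    have h1 := integrableOn_mul_of_tsupport_subset hfi (memLp_top_of_continuous hψ hψc) hψc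
      (hψB.trans hrD)
    refine (integrableOn_iff_integrable_of_support_subset fun x hx => ?_).1 h1
    by_contra hc
    exact hx (by simp [hψ0 x fun hb => hc (hrD hb)])
  set T : E → ℝ := fun x => inner ℝ a (f x₀ + A (x - x₀)) with hT
  have hTc : Continuous T := by fun_prop
  have hTd : ∀ x, HasFDerivAt T ((innerSL ℝ a).comp A) x := by
    intro x
    have h1 : HasFDerivAt (fun x => f x₀ + A (x - x₀)) A x := by
      simpa using (A.hasFDerivAt.comp x ((hasFDerivAt_id x).sub_const x₀)).const_add (f x₀)
    exact (innerSL ℝ a).hasFDerivAt.comp x h1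
  have hI2 : Integrable fun x => T x * fderiv ℝ φ x h :=
    (hTc.mul hψ).integrable_of_hasCompactSupport hψc.mul_left
  have hTi : ∫ x, T x * fderiv ℝ φ x h = -(inner ℝ a (A h) * ∫ x, φ x) := by
    rw [integral_mul_fderiv_eq_neg_fderiv_mul_of_integrable _ hI2
      ((hTc.mul hφ.continuous).integrable_of_hasCompactSupport hφc.mul_left)
      (fun x _ => (hTd x).differentiableAt) (fun x _ => hφ.differentiable (by simp) x)]
    · simp only [(hTd _).fderiv]
      rw [← integral_const_mul]
      rfl
    · simp only [(hTd _).fderiv]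
      exact (hφ.continuous.integrable_of_hasCompactSupport hφc).const_mul _
  have hφi : ∫ x, φ x = r ^ n * ∫ x, χ x := integral_comp_rescale (fun x => χ x) x₀ hr
  have hψi : ∫ x, |fderiv ℝ φ x h| = r⁻¹ * (r ^ n * ∫ x, |fderiv ℝ χ x h|) := by
    rw [← integral_comp_rescale (fun x => |fderiv ℝ χ x h|) x₀ hr, ← integral_const_mul]
    refine integral_congr_ae (Eventually.of_forall fun x => ?_)
    simp only [hφdef, fderiv_scaledBump]
    rw [abs_mul, abs_of_pos (inv_pos.2 hr)]
  have hdiff : |∫ x, (inner ℝ a (f x) * fderiv ℝ φ x h - T x * fderiv ℝ φ x h)| ≤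
      (ε * r) * ∫ x, |fderiv ℝ φ x h| := by
    rw [← integral_const_mul, ← Real.norm_eq_abs]
    refine norm_integral_le_of_norm_le ((hψ.abs.integrable_of_hasCompactSupport
      hψc.abs).const_mul _) (Eventually.of_forall fun x => ?_)
    rw [← sub_mul, norm_mul, Real.norm_eq_abs, Real.norm_eq_abs]
    by_cases hx : x ∈ Metric.closedBall x₀ r
    · refine mul_le_mul_of_nonneg_right ?_ (abs_nonneg _)
      rw [hT]
      simp only
      rw [← inner_sub_right, ← sub_sub]
      refine (abs_real_inner_le_norm _ _).trans ?_
      have := hA x hx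
      nlinarith [norm_nonneg a, norm_nonneg (f x - f x₀ - A (x - x₀))]
    · rw [hψ0 x hx]; simp
  rw [integral_sub hI1 hI2, hTi, hψi, hφi] at hdiff
  rw [setIntegral_eq_integral_of_forall_compl_eq_zero fun x hx => by
    rw [hψ0 x fun hb => hx (hrD hb), mul_zero]]
  have h8 : (ε * r) * (r⁻¹ * (r ^ n * ∫ x, |fderiv ℝ χ x h|)) =
      (ε * ∫ x, |fderiv ℝ χ x h|) * r ^ n := by
    field_simp
  rw [h8] at hdiff
  have h9 := (abs_le.1 hdiff).2
  have h10 := neg_abs_le (∫ x, inner ℝ a (f x) * fderiv ℝ φ x h)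
  linarith

/-- The properties of a homeomorphism of the class `W^{1,1}_loc` with finite dilatation that are
used in the limit theorems. -/
structure FiniteDistortion (D : Set (EuclideanSpace ℝ (Fin n)))
    (f : EuclideanSpace ℝ (Fin n) → EuclideanSpace ℝ (Fin n)) : Prop where
  continuousOn : ContinuousOn f D
  isWeakPartial : ∀ k i, IsWeakPartial D i (fun x => f x k) fun x => jacobian f x k i
  aemeasurable : AEMeasurable (dilatationP f) (volume.restrict D)
  ae_ne_top : ∀ᵐ x ∂volume.restrict D, dilatationP f x ≠ ⊤
  lintegral_le : ∀ S : Set (EuclideanSpace ℝ (Fin n)), MeasurableSet S → S ⊆ D →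
    ∫⁻ x in S, ENNReal.ofReal |(jacobian f x).det| ≤ volume (f '' S)

theorem finiteDistortion_of_isHomeoInto (hn : 2 ≤ n) {D : Set E} (hD : IsOpen D) {f : E → E}
    (hf : IsHomeoInto D f) (hs : MemW11Loc D f)
    (hfin : ∀ᵐ x ∂volume.restrict D, dilatationP f x ≠ ⊤) : FiniteDistortion D f := by
  have hp := hfin.mono fun x hx => hasPartials_of_dilatationP_ne_top hn hx
  have hc : ContinuousOn f D := continuousOn_iff_continuous_domRestrict.2 hf.continuous
  exact ⟨hc, hs.isWeakPartial_jacobian hD hp, aemeasurable_dilatationP hD hs hp, hfin,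
    fun S hS hSD => lintegral_abs_det_jacobian_le hD hc (Set.injOn_iff_injective.2 hf.injective) hp
      hS hSD⟩

theorem opNorm_pow_le_of_eventually_lintegral_le (hn : 2 ≤ n) {D : Set E} (hD : IsOpen D)
    {F : ℕ → E → E} {f : E → E} (hF : ∀ j, FiniteDistortion D (F j))
    (hlim : TendstoLocallyUniformlyOn F f atTop D) {x₀ : E} (hx₀ : x₀ ∈ D)
    (hf : DifferentiableAt ℝ f x₀) {H : ℝ} (hH : 0 < H)
    (hP : ∀ ε > 0, ∀ᶠ r : ℝ in 𝓝[>] 0, ∀ᶠ j in atTop,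
      ∫⁻ x in Metric.closedBall x₀ r, dilatationP (F j) x ≤
        ENNReal.ofReal (H + ε) * volume (Metric.closedBall x₀ r)) :
    opNorm (jacobian f x₀) ^ n ≤ H ^ (n - 1) * |(jacobian f x₀).det| := by
  have hn0 : (2 : ℝ) ≤ n := by exact_mod_cast hn
  have hfc : ContinuousOn f D := hlim.continuousOn (Frequently.of_forall fun j => (hF j).continuousOn)
  have hJ := jacobianCLM_eq_fderiv hf
  have hdet : (fderiv ℝ f x₀).det = (jacobian f x₀).det := by
    rw [← hJ, jacobianCLM, det_toEuclideanCLM]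
  refine pow_le_of_forall_young hn (opNorm_nonneg _) hH (abs_nonneg _) fun t ht => ?_
  have hc1 : 0 ≤ ((n : ℝ) - 1) / n * t :=
    mul_nonneg (div_nonneg (by linarith) (by linarith)) ht.le
  have hc2 : 0 ≤ 1 / n * (t ^ (n - 1))⁻¹ := by positivity
  set c₁ := ((n : ℝ) - 1) / n * t with hc₁
  set c₂ := 1 / n * (t ^ (n - 1))⁻¹ with hc₂
  set d := |(jacobian f x₀).det| with hd
  have hd0 : 0 ≤ d := abs_nonneg _
  set β := (volume (Metric.closedBall (0 : E) 1)).toReal with hβ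
  have hβ0 : 0 < β := ENNReal.toReal_pos (Metric.measure_closedBall_pos _ _ one_pos).ne'
    measure_closedBall_lt_top.ne
  have hvol : ∀ r : ℝ, 0 < r → volume (Metric.closedBall x₀ r) = ENNReal.ofReal (r ^ n * β) := by
    intro r hr
    rw [Measure.addHaar_closedBall' _ _ hr.le, finrank_euclideanSpace_fin,
      ENNReal.ofReal_mul (by positivity), hβ, ENNReal.ofReal_toReal measure_closedBall_lt_top.ne]
  -- A single small radius r suffices for given ε: let j → ∞ on that ball and divide by r^n.
  have step1 : ∀ (χ : ContDiffBump (0 : E)), χ.rOut = 1 → ∀ a h : E, ‖a‖ ≤ 1 → ‖h‖ ≤ 1 → ∀ ε > 0,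
      inner ℝ a (fderiv ℝ f x₀ h) * ∫ x, χ x ≤
        (c₁ * (H + ε) + c₂ * (d + ε)) * β + ε * ∫ x, |fderiv ℝ χ x h| := by
    intro χ hχ a h ha hh ε hε
    obtain ⟨r, hrD, hrA, hrV, hrP, hr⟩ := ((closedBall_subset_eventually hD hx₀).and
      ((eventually_norm_sub_sub_le hf hε).and
      ((eventually_volume_image_closedBall_le hD hlim hx₀ hf
        (m := d + ε) (by rw [hdet]; linarith)).and ((hP ε hε).and self_mem_nhdsWithin)))).exists
    have hr : 0 < r := hr
    set φ := scaledBump χ x₀ r with hφdef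
    have hφ : ContDiff ℝ ∞ φ := contDiff_scaledBump χ x₀ r
    have hφc : HasCompactSupport φ := hasCompactSupport_scaledBump χ hχ x₀ hr
    have hφB : tsupport φ ⊆ Metric.closedBall x₀ r := tsupport_scaledBump_subset χ hχ x₀ hr
    have hφ1 : ∀ x, |φ x| ≤ 1 := fun x => by
      have h0 : 0 ≤ φ x := χ.nonneg
      rw [abs_of_nonneg h0]; exact χ.le_one
    have hψ : Continuous fun x => fderiv ℝ φ x h :=
      (hφ.continuous_fderiv (by simp)).clm_apply continuous_const
    have hψc : HasCompactSupport fun x => fderiv ℝ φ x h := hφc.fderiv_apply ℝ h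
    have hψB : tsupport (fun x => fderiv ℝ φ x h) ⊆ Metric.closedBall x₀ r :=
      (tsupport_fderiv_apply_subset ℝ h).trans hφB
    have hconv : Tendsto (fun j => ∫ x in D, inner ℝ a (F j x) * fderiv ℝ φ x h) atTop
        (𝓝 (∫ x in D, inner ℝ a (f x) * fderiv ℝ φ x h)) := by
      refine tendsto_setIntegral_mul_of_tendstoUniformlyOn
        (fun j => (continuousOn_const.inner (hF j).continuousOn).locallyIntegrableOn
          hD.measurableSet)
        ((continuousOn_const.inner hfc).locallyIntegrableOn hD.measurableSet) hψ hψc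
        (hψB.trans hrD) ?_
      exact (innerSL ℝ a).uniformContinuous.comp_tendstoUniformlyOn
        (tendstoUniformlyOn_of_isCompact hlim hψc (hψB.trans hrD))
    have hbound : ∀ᶠ j in atTop, |∫ x in D, inner ℝ a (F j x) * fderiv ℝ φ x h| ≤
        (c₁ * (H + ε) + c₂ * (d + ε)) * (r ^ n * β) := by
      filter_upwards [hrV, hrP] with j hjV hjP
      have h1 := enorm_setIntegral_inner_mul_fderiv_le hn
        (Metric.isClosed_closedBall (x := x₀) (ε := r)).measurableSet hrD
        (hF j).isWeakPartial (hF j).aemeasurable (hF j).ae_ne_top hφ hφc hφB hφ1 ha hh ht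
      have h2 := ((hF j).lintegral_le _ Metric.isClosed_closedBall.measurableSet hrD).trans hjV
      rw [hvol r hr, ← ENNReal.ofReal_mul (by positivity)] at h2 hjP
      have h3 := h1.trans (add_le_add (mul_le_mul_right hjP _) (mul_le_mul_right h2 _))
      rw [← hc₁, ← hc₂, ← ENNReal.ofReal_mul hc1, ← ENNReal.ofReal_mul hc2,
        ← ENNReal.ofReal_add (by positivity) (by positivity), Real.enorm_eq_ofReal_abs,
        ENNReal.ofReal_le_ofReal_iff (by positivity)] at h3
      linarith
    have h4 := le_of_tendsto hconv.abs hbound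
    have h5 := (le_abs_setIntegral_inner_mul_fderiv_scaledBump hD hfc χ hχ hr hrD _ hrA ha h).trans h4
    have hrn : 0 < r ^ n := by positivity
    nlinarith
  have step2 : ∀ (χ : ContDiffBump (0 : E)), χ.rOut = 1 → ∀ a h : E, ‖a‖ ≤ 1 → ‖h‖ ≤ 1 →
      inner ℝ a (fderiv ℝ f x₀ h) * ∫ x, χ x ≤ (c₁ * H + c₂ * d) * β := by
    intro χ hχ a h ha hh
    have hcont : Continuous fun ε : ℝ =>
        (c₁ * (H + ε) + c₂ * (d + ε)) * β + ε * ∫ x, |fderiv ℝ χ x h| := by fun_prop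
    have h1 := (hcont.tendsto 0).mono_left (nhdsWithin_le_nhds (s := Set.Ioi 0))
    simp only [add_zero, zero_mul] at h1
    refine ge_of_tendsto h1 ?_
    filter_upwards [self_mem_nhdsWithin] with ε hε using step1 χ hχ a h ha hh ε hε
  have step3 : ∀ a h : E, ‖a‖ ≤ 1 → ‖h‖ ≤ 1 → inner ℝ a (fderiv ℝ f x₀ h) ≤ c₁ * H + c₂ * d := by
    intro a h ha hh
    rcases le_or_gt (inner ℝ a (fderiv ℝ f x₀ h)) 0 with h0 | h0
    · exact h0.trans (by positivity)
    -- A bump equal to 1 on the ball of radius ρ has integral at least ρ^n β; letting ρ → 1 loses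
    -- nothing.
    have h1 : ∀ ρ ∈ Set.Ioo (0 : ℝ) 1, inner ℝ a (fderiv ℝ f x₀ h) * ρ ^ n ≤ c₁ * H + c₂ * d := by
      intro ρ hρ
      have h2 := step2 ⟨ρ, 1, hρ.1, hρ.2⟩ rfl a h ha hh
      have h3 := ContDiffBump.measure_closedBall_le_integral (μ := (volume : Measure E))
        (⟨ρ, 1, hρ.1, hρ.2⟩ : ContDiffBump (0 : E))
      have h4 : (volume : Measure E).real (Metric.closedBall 0 ρ) = ρ ^ n * β := by
        rw [Measure.real, Measure.addHaar_closedBall' _ _ hρ.1.le, finrank_euclideanSpace_fin,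
          ENNReal.toReal_mul, ENNReal.toReal_ofReal (pow_nonneg hρ.1.le n)]
      rw [h4] at h3
      have h5 := (mul_le_mul_of_nonneg_left h3 h0.le).trans h2
      rw [← mul_assoc] at h5
      exact le_of_mul_le_mul_right h5 hβ0
    have hcont : Continuous fun ρ : ℝ => inner ℝ a (fderiv ℝ f x₀ h) * ρ ^ n := by fun_prop
    have h2 := (hcont.tendsto 1).mono_left (nhdsWithin_le_nhds (s := Set.Iio 1))
    simp only [one_pow, mul_one] at h2
    refine le_of_tendsto h2 ?_
    filter_upwards [Ioo_mem_nhdsLT (zero_lt_one' ℝ)] with ρ hρ using h1 ρ hρ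
  have h6 : opNorm (jacobian f x₀) = ‖fderiv ℝ f x₀‖ := by rw [← hJ]; rfl
  rw [h6]
  refine ContinuousLinearMap.opNorm_le_of_unit_norm (by positivity) fun h hh => ?_
  rcases eq_or_ne (fderiv ℝ f x₀ h) 0 with h0 | h0
  · rw [h0, norm_zero]; positivity
  -- The unit vector a in the direction of f'(x₀)h turns the inner product into the norm.
  · have h7 := step3 (‖fderiv ℝ f x₀ h‖⁻¹ • fderiv ℝ f x₀ h) h
      (by rw [norm_smul, norm_inv, norm_norm, inv_mul_cancel₀ (norm_ne_zero_iff.2 h0)]) hh.le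
    rwa [real_inner_smul_left, real_inner_self_eq_norm_sq, sq, ← mul_assoc,
      inv_mul_cancel₀ (norm_ne_zero_iff.2 h0), one_mul] at h7

/-- Upper semicontinuity of the dilatation under locally uniform convergence. -/
theorem ae_dilatationP_le_limsup (hn : 2 ≤ n) {D : Set E} (hD : IsOpen D)
    {F : ℕ → E → E} {f : E → E} (hF : ∀ j, FiniteDistortion D (F j))
    (hlim : TendstoLocallyUniformlyOn F f atTop D)
    (hf : ∀ᵐ x ∂volume.restrict D, DifferentiableAt ℝ f x)
    {P : E → ℝ} (hP : LocallyIntegrableOn P D)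
    (hFP : ∀ j, ∀ᵐ x ∂volume.restrict D, dilatationP (F j) x ≤ ENNReal.ofReal (P x)) :
    ∀ᵐ x ∂volume.restrict D,
      dilatationP f x ≤ limsup (fun j => dilatationP (F j) x) atTop := by
  filter_upwards [hf, ae_restrict_mem hD.measurableSet, ae_all_iff.2 hFP,
    ae_eventually_lintegral_closedBall_le hD hP (fun j => (hF j).aemeasurable) hFP] with
    x hx hxD hxP hxH
  set H := limsup (fun j => dilatationP (F j) x) atTop with hHdef
  have hHtop : H ≠ ⊤ :=
    ((limsup_le_of_le (h := Eventually.of_forall hxP)).trans_lt ENNReal.ofReal_lt_top).ne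
  have hH1 : 1 ≤ H := le_limsup_of_frequently_le
    (Frequently.of_forall fun j => one_le_dilatationP hn (F j) x)
  have hH1' : 1 ≤ H.toReal := by
    rw [← ENNReal.toReal_one]; exact ENNReal.toReal_mono hHtop hH1
  rw [← ENNReal.ofReal_toReal hHtop]
  refine dilatationP_le_ofReal hn (fun i => hx.lineDifferentiableAt) hH1' ?_
  refine opNorm_pow_le_of_eventually_lintegral_le hn hD hF hlim hxD hx (by linarith) fun ε hε => ?_
  refine hxH _ ?_
  conv_lhs => rw [← ENNReal.ofReal_toReal hHtop]
  exact (ENNReal.ofReal_lt_ofReal_iff (by linarith)).2 (by linarith)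

end Semicontinuity

/-! ### Weak compactness in Hilbert space and in weighted L². -/

section WeakLimit

/-- A bounded sequence in a Hilbert space converges weakly if its pairings with a total set do. -/
theorem exists_weak_limit_of_bounded {H : Type*} [NormedAddCommGroup H] [InnerProductSpace ℝ H]
    [CompleteSpace H] {h : ℕ → H} {C : ℝ} (hC : ∀ j, ‖h j‖ ≤ C) {S : Set H}
    (hS : ∀ g : H, (∀ s ∈ S, inner ℝ g s = 0) → g = 0)
    (hconv : ∀ s ∈ S, ∃ l, Tendsto (fun j => inner ℝ (h j) s) atTop (𝓝 l)) :
    ∃ g : H, ∀ v : H, Tendsto (fun j => inner ℝ (h j) v) atTop (𝓝 (inner ℝ g v)) := by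
  have hC0 : 0 ≤ C := (norm_nonneg _).trans (hC 0)
  -- The vectors with Cauchy pairings form a subspace containing the dense span of `S`; the uniform
  -- norm bound extends the Cauchy property to the closure.
  let V : Submodule ℝ H :=
    { carrier := {v | CauchySeq fun j => inner ℝ (h j) v}
      add_mem' := fun {a b} ha hb => by
        have : CauchySeq fun j => inner ℝ (h j) (a + b) := by
          simp only [inner_add_right]; exact CauchySeq.add ha hb
        exact this
      zero_mem' := by
        have : CauchySeq fun j => inner ℝ (h j) (0 : H) := by
          simp only [inner_zero_right]; exact cauchySeq_const _
        exact this
      smul_mem' := fun c a ha => by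
        have : CauchySeq fun j => inner ℝ (h j) (c • a) := by
          simp only [inner_smul_right]
          exact (uniformContinuous_const_smul c).comp_cauchySeq ha
        exact this }
  have hVmem : ∀ v, v ∈ V ↔ CauchySeq fun j => inner ℝ (h j) v := fun v => Iff.rfl
  have hspan : (Submodule.span ℝ S).topologicalClosure = ⊤ := by
    rw [Submodule.topologicalClosure_eq_top_iff, Submodule.eq_bot_iff]
    intro g hg
    refine hS g fun s hs => ?_
    rw [real_inner_comm]
    exact (Submodule.mem_orthogonal _ _).1 hg s (Submodule.subset_span hs)
  have hSV : Submodule.span ℝ S ≤ V := Submodule.span_le.2 fun s hs => by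
    obtain ⟨l, hl⟩ := hconv s hs
    exact (hVmem s).2 hl.cauchySeq
  have hall : ∀ v : H, CauchySeq fun j => inner ℝ (h j) v := by
    intro v
    have hv : v ∈ closure (Submodule.span ℝ S : Set H) := by
      rw [← Submodule.topologicalClosure_coe, hspan]; trivial
    rw [Metric.cauchySeq_iff]
    intro ε hε
    obtain ⟨s, hs, hvs⟩ := Metric.mem_closure_iff.1 hv (ε / (3 * (C + 1))) (by positivity)
    obtain ⟨N, hN⟩ := Metric.cauchySeq_iff.1 ((hVmem s).1 (hSV hs)) (ε / 3) (by positivity)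
    refine ⟨N, fun m hm k hk => ?_⟩
    have h1 : ∀ j, dist (inner ℝ (h j) v) (inner ℝ (h j) s) < ε / 3 := by
      intro j
      rw [Real.dist_eq, ← inner_sub_right]
      refine (abs_real_inner_le_norm _ _).trans_lt ?_
      rw [← dist_eq_norm]
      calc ‖h j‖ * dist v s ≤ (C + 1) * dist v s := by gcongr; linarith [hC j]
        _ < (C + 1) * (ε / (3 * (C + 1))) := by gcongr
        _ = ε / 3 := by field_simp
    have h2 := dist_triangle4_right (inner ℝ (h m) v) (inner ℝ (h k) v) (inner ℝ (h m) s)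
      (inner ℝ (h k) s)
    linarith [h1 m, h1 k, hN m hm k hk]
  choose T hT using fun v => cauchySeq_tendsto_of_complete (hall v)
  -- The pointwise limit functional is continuous by Banach–Steinhaus, and Riesz representation
  -- supplies the weak limit.
  let L : H →L[ℝ] ℝ := continuousLinearMapOfTendsto (fun j => innerSL ℝ (h j))
    (f := T) (tendsto_pi_nhds.2 hT)
  refine ⟨(InnerProductSpace.toDual ℝ H).symm L, fun v => ?_⟩
  rw [InnerProductSpace.toDual_symm_apply]
  exact hT v

theorem locallyIntegrableOn_of_forall_isCompact {D : Set E} (hD : IsOpen D) {u : E → ℝ}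
    (h : ∀ K ⊆ D, IsCompact K → IntegrableOn u K) : LocallyIntegrableOn u D :=
  (locallyIntegrableOn_iff hD.isLocallyClosed).2 fun K hK hKc => h K hK hKc

/-- Weak compactness in a weighted `L²` space, expressed by test functions. -/
theorem exists_weak_limit_of_weighted_bound {D : Set E} (hD : IsOpen D) {w : E → ℝ}
    (hwm : Measurable w) (hw0 : ∀ x ∈ D, 0 < w x)
    (hw2 : LocallyIntegrableOn (fun x => w x ^ 2) D) {G : ℕ → E → ℝ}
    (hGm : ∀ j, AEStronglyMeasurable (G j) (volume.restrict D)) {C : ℝ}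
    (hGi : ∀ j, IntegrableOn (fun x => (G j x / w x) ^ 2) D)
    (hGC : ∀ j, ∫ x in D, (G j x / w x) ^ 2 ≤ C)
    (hconv : ∀ φ : E → ℝ, ContDiff ℝ ∞ φ → HasCompactSupport φ → tsupport φ ⊆ D →
      ∃ l, Tendsto (fun j => ∫ x in D, G j x * φ x) atTop (𝓝 l)) :
    ∃ g : E → ℝ, LocallyIntegrableOn g D ∧
      ∀ φ : E → ℝ, MemLp φ ⊤ volume → HasCompactSupport φ → tsupport φ ⊆ D →
        Tendsto (fun j => ∫ x in D, G j x * φ x) atTop (𝓝 (∫ x in D, g x * φ x)) := by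
  set μ := (volume : Measure E).restrict D with hμ
  have hwae : ∀ᵐ x ∂μ, 0 < w x := (ae_restrict_mem hD.measurableSet).mono hw0
  have hG2 : ∀ j, MemLp (fun x => G j x / w x) 2 μ := fun j =>
    (memLp_two_iff_integrable_sq
      ((hGm j).aemeasurable.div hwm.aemeasurable).aestronglyMeasurable).2 (hGi j)
  have hφ2 : ∀ φ : E → ℝ, MemLp φ ⊤ volume → HasCompactSupport φ → tsupport φ ⊆ D →
      MemLp (fun x => φ x * w x) 2 μ := by
    intro φ hφ hφc hφD
    refine (memLp_two_iff_integrable_sq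
      (hφ.1.restrict.mul hwm.aestronglyMeasurable)).2 ?_
    have h1 : MemLp (fun x => φ x * φ x) ⊤ volume := hφ.mul hφ
    have h2 := integrableOn_mul_of_tsupport_subset hw2 h1 (hφc.mul_left)
      ((tsupport_mul_subset_left (f := φ) (g := φ)).trans hφD)
    refine h2.congr (Eventually.of_forall fun x => ?_)
    simp only [Pi.mul_apply]
    ring
  have hinner : ∀ (u v : E → ℝ) (hu : MemLp u 2 μ) (hv : MemLp v 2 μ),
      inner ℝ (hu.toLp u) (hv.toLp v) = ∫ x, u x * v x ∂μ := by
    intro u v hu hv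
    rw [L2.inner_def]
    refine integral_congr_ae ?_
    filter_upwards [hu.coeFn_toLp, hv.coeFn_toLp] with x hx hx'
    rw [hx, hx']
    simp [mul_comm]
  have hlp : ∀ h : Lp ℝ 2 μ, LocallyIntegrableOn (fun x => h x * w x) D := by
    intro h
    refine locallyIntegrableOn_of_forall_isCompact hD fun K hKD hK => ?_
    have h1 : IntegrableOn (fun x => w x ^ 2) K := hw2.integrableOn_compact_subset hKD hK
    have h2 : Integrable (fun x => h x ^ 2) μ := (Lp.memLp h).integrable_sq
    have h3 : IntegrableOn (fun x => h x ^ 2) K :=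
      h2.mono_measure (Measure.restrict_mono hKD le_rfl)
    refine Integrable.mono' (h3.add h1) ?_ (Eventually.of_forall fun x => ?_)
    · exact (((Lp.memLp h).1.mono_measure (Measure.restrict_mono hKD le_rfl)).mul
        hwm.aestronglyMeasurable)
    · rw [norm_mul, Real.norm_eq_abs, Real.norm_eq_abs, Pi.add_apply, ← sq_abs (h x),
        ← sq_abs (w x)]
      nlinarith [sq_nonneg (|h x| - |w x|), abs_nonneg (h x), abs_nonneg (w x)]
  -- The pairing of G with φ is the L² product of G/w and φ w. The products φ w with smooth φ are
  -- total: if g is orthogonal to them, then g w vanishes a.e., and w > 0.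
  let S : Set (Lp ℝ 2 μ) := {s | ∃ (φ : E → ℝ) (hφ : ContDiff ℝ ∞ φ) (hφc : HasCompactSupport φ)
    (hφD : tsupport φ ⊆ D),
    s = (hφ2 φ (memLp_top_of_continuous hφ.continuous hφc) hφc hφD).toLp _}
  have hpair : ∀ j, ∀ (φ : E → ℝ) (hφ : MemLp φ ⊤ volume) (hφc : HasCompactSupport φ)
      (hφD : tsupport φ ⊆ D), inner ℝ ((hG2 j).toLp _) ((hφ2 φ hφ hφc hφD).toLp _) =
        ∫ x in D, G j x * φ x := by
    intro j φ hφ hφc hφD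
    rw [hinner]
    refine integral_congr_ae ?_
    filter_upwards [hwae] with x hx
    field_simp
  have hpair' : ∀ (h : Lp ℝ 2 μ) (φ : E → ℝ) (hφ : MemLp φ ⊤ volume) (hφc : HasCompactSupport φ)
      (hφD : tsupport φ ⊆ D), inner ℝ h ((hφ2 φ hφ hφc hφD).toLp _) =
        ∫ x in D, (h x * w x) * φ x := by
    intro h φ hφ hφc hφD
    rw [L2.inner_def]
    refine integral_congr_ae ?_
    filter_upwards [(hφ2 φ hφ hφc hφD).coeFn_toLp] with x hx
    rw [hx]
    simp only [RCLike.inner_apply, conj_trivial]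
    ring
  obtain ⟨h, hh⟩ := exists_weak_limit_of_bounded (h := fun j => (hG2 j).toLp _) (C := √C) (S := S)
    (by
      intro j
      refine Real.le_sqrt_of_sq_le ?_
      rw [← real_inner_self_eq_norm_sq, hinner]
      simpa only [sq] using hGC j)
    (by
      intro g hg
      have h1 := hD.ae_eq_zero_of_integral_contDiff_smul_eq_zero (hlp g) (by
        intro φ hφ hφc hφD
        have h2 := hg _ ⟨φ, hφ, hφc, hφD, rfl⟩
        rw [hpair' g φ (memLp_top_of_continuous hφ.continuous hφc) hφc hφD] at h2
        rw [← h2, setIntegral_eq_integral_of_forall_compl_eq_zero]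
        · simp only [smul_eq_mul, mul_comm]
        · intro x hx
          rw [image_eq_zero_of_notMem_tsupport fun hc => hx (hφD hc), mul_zero])
      rw [Lp.eq_zero_iff_ae_eq_zero]
      filter_upwards [ae_restrict_of_ae h1, ae_restrict_mem hD.measurableSet] with x hx hxD
      exact (mul_eq_zero.1 (hx hxD)).resolve_right (hw0 x hxD).ne')
    (by
      rintro _ ⟨φ, hφ, hφc, hφD, rfl⟩
      obtain ⟨l, hl⟩ := hconv φ hφ hφc hφD
      exact ⟨l, hl.congr fun j =>
        (hpair j φ (memLp_top_of_continuous hφ.continuous hφc) hφc hφD).symm⟩)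
  refine ⟨fun x => h x * w x, hlp h, fun φ hφ hφc hφD => ?_⟩
  have h1 := hh ((hφ2 φ hφ hφc hφD).toLp _)
  rw [hpair' h φ hφ hφc hφD] at h1
  exact h1.congr fun j => hpair j φ hφ hφc hφD

end WeakLimit

/-! ### Weak convergence of the derivatives. -/

section WeakConvergence

theorem abs_apply_le_opNorm (A : Matrix (Fin n) (Fin n) ℝ) (k i : Fin n) : |A k i| ≤ opNorm A := by
  have h1 := (Matrix.toEuclideanCLM (n := Fin n) (𝕜 := ℝ) A).le_opNorm (e i)
  have h2 := PiLp.norm_apply_le (Matrix.toEuclideanCLM (n := Fin n) (𝕜 := ℝ) A (e i)) k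
  have h3 : (Matrix.toEuclideanCLM (n := Fin n) (𝕜 := ℝ) A (e i)) k = A k i := by
    simp [Matrix.ofLp_toEuclideanCLM]
  have h4 : ‖(e i : E)‖ = 1 := by simp
  rw [h4, mul_one] at h1
  rw [h3] at h2
  exact h2.trans h1

/-- Either a ≤ p, or p^(n-2) a² ≤ a^n and a power of p cancels. Lowering the exponent to 2 brings
Hilbert space methods within reach while p and J are only integrable. -/
theorem sq_le_of_pow_le (hn : 2 ≤ n) {a p J : ℝ} (ha : 0 ≤ a) (hp : 0 < p) (hJ : 0 ≤ J)
    (h : a ^ n ≤ p ^ (n - 1) * J) : a ^ 2 ≤ p * (p + J) := by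
  rcases le_total a p with hap | hap
  · nlinarith [mul_nonneg hp.le hJ]
  · obtain ⟨m, rfl⟩ := Nat.exists_eq_add_of_le hn
    have h1 : p ^ m * a ^ 2 ≤ p ^ m * (p * J) := by
      calc p ^ m * a ^ 2 ≤ a ^ m * a ^ 2 := by gcongr
        _ = a ^ (2 + m) := by ring
        _ ≤ p ^ (2 + m - 1) * J := h
        _ = p ^ m * (p * J) := by
          rw [show 2 + m - 1 = m + 1 by omega]; ring
    have h2 := le_of_mul_le_mul_left h1 (by positivity)
    nlinarith

theorem exists_compact_exhaustion {D : Set E} (hD : IsOpen D) :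
    ∃ K : ℕ → Set E, (∀ m, IsCompact (K m) ∧ K m ⊆ D) ∧
      ∀ C ⊆ D, IsCompact C → ∃ m, C ⊆ K m := by
  have : LocallyCompactSpace D := hD.locallyCompactSpace
  let X := CompactExhaustion.choice D
  refine ⟨fun m => Subtype.val '' X m, fun m => ⟨(X.isCompact m).image continuous_subtype_val,
    Subtype.coe_image_subset D _⟩, fun C hCD hC => ?_⟩
  have h1 : IsCompact (Subtype.val ⁻¹' C : Set D) :=
    Topology.IsInducing.subtypeVal.isCompact_preimage_iff (by simpa using hCD) |>.2 hC
  obtain ⟨m, hm⟩ := X.exists_superset_of_isCompact h1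
  exact ⟨m, fun x hx => ⟨⟨x, hCD hx⟩, hm hx, rfl⟩⟩

/-- All but finitely many images lie within distance 1 of the bounded set f(K), and each remaining
one is compact. -/
theorem exists_volume_image_le {D K : Set E} (hK : IsCompact K) (hKD : K ⊆ D) {F : ℕ → E → E}
    {f : E → E} (hF : ∀ j, ContinuousOn (F j) D) (hlim : TendstoLocallyUniformlyOn F f atTop D) :
    ∃ M : ℝ≥0∞, M ≠ ⊤ ∧ ∀ j, volume (F j '' K) ≤ M := by
  have hf : ContinuousOn f D := hlim.continuousOn (Frequently.of_forall hF)
  obtain ⟨R, hR⟩ := (hK.image_of_continuousOn (hf.mono hKD)).isBounded.subset_closedBall 0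
  obtain ⟨N, hN⟩ := eventually_atTop.1 (Metric.tendstoUniformlyOn_iff.1
    (tendstoUniformlyOn_of_isCompact hlim hK hKD) 1 one_pos)
  refine ⟨volume (Metric.closedBall (0 : E) (R + 1)) + ∑ j ∈ Finset.range N, volume (F j '' K),
    ?_, fun j => ?_⟩
  · refine ENNReal.add_ne_top.2 ⟨measure_closedBall_lt_top.ne, ENNReal.sum_ne_top.2 fun j _ => ?_⟩
    exact (hK.image_of_continuousOn ((hF j).mono hKD)).measure_lt_top.ne
  · rcases lt_or_ge j N with hj | hj
    · exact (Finset.single_le_sum (f := fun j => volume (F j '' K)) (fun _ _ => zero_le)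
        (Finset.mem_range.2 hj)).trans le_add_self
    · refine (measure_mono ?_).trans le_self_add
      rintro _ ⟨x, hx, rfl⟩
      have h1 := hN j hj x hx
      have h2 := Metric.mem_closedBall.1 (hR ⟨x, hx, rfl⟩)
      rw [Metric.mem_closedBall]
      have h3 := dist_triangle (F j x) (f x) 0
      rw [dist_comm] at h1
      linarith

/-- The Jacobian matrices of a convergent sequence of maps with dominated dilatations are bounded
in a weighted `L²` space. -/
theorem exists_weight (hn : 2 ≤ n) {D : Set E} (hD : IsOpen D) {F : ℕ → E → E} {f : E → E}
    (hF : ∀ j, FiniteDistortion D (F j)) (hlim : TendstoLocallyUniformlyOn F f atTop D)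
    {P : E → ℝ} (hP : LocallyIntegrableOn P D)
    (hFP : ∀ j, ∀ᵐ x ∂volume.restrict D, dilatationP (F j) x ≤ ENNReal.ofReal (P x)) :
    ∃ w : E → ℝ, Measurable w ∧ (∀ x ∈ D, 0 < w x) ∧ LocallyIntegrableOn (fun x => w x ^ 2) D ∧
      ∀ j k i, IntegrableOn (fun x => (jacobian (F j) x k i / w x) ^ 2) D ∧
        ∫ x in D, (jacobian (F j) x k i / w x) ^ 2 ≤ 1 := by
  obtain ⟨K, hK, hKabs⟩ := exists_compact_exhaustion hD
  have hPm := hP.aestronglyMeasurable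
  set p : E → ℝ := fun x => max (hPm.mk P x) 1 with hp
  have hpm : Measurable p := hPm.stronglyMeasurable_mk.measurable.max measurable_const
  have hp1 : ∀ x, 1 ≤ p x := fun x => le_max_right _ _
  have hpi : ∀ C ⊆ D, IsCompact C → IntegrableOn p C := by
    intro C hCD hC
    have h1 : IntegrableOn (hPm.mk P) C := (hP.integrableOn_compact_subset hCD hC).congr
      (ae_mono (Measure.restrict_mono hCD le_rfl) hPm.ae_eq_mk)
    exact h1.sup (integrableOn_const hC.measure_lt_top.ne)
  have hFp : ∀ j, ∀ᵐ x ∂volume.restrict D, dilatationP (F j) x ≤ ENNReal.ofReal (p x) := by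
    intro j
    filter_upwards [hFP j, hPm.ae_eq_mk] with x hx hx'
    refine hx.trans (ENNReal.ofReal_le_ofReal ?_)
    rw [hx']; exact le_max_left _ _
  choose V hVtop hV using fun m => exists_volume_image_le (hK m).1 (hK m).2
    (fun j => (hF j).continuousOn) hlim
  -- This bounds the integral of p + |J_j| over `K m` for all j at once; the summand 1 ensures c m ≤
  -- δ m below.
  set M : ℕ → ℝ≥0∞ := fun m => (∫⁻ x in K m, ENNReal.ofReal (p x)) + V m + 1 with hM
  have hMtop : ∀ m, M m ≠ ⊤ := by
    intro m
    have h1 := (hpi (K m) (hK m).2 (hK m).1)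
    have h2 : ∫⁻ x in K m, ENNReal.ofReal (p x) ≠ ⊤ :=
      ((lintegral_mono fun x => Real.ofReal_le_enorm (p x)).trans_lt h1.2).ne
    exact ENNReal.add_ne_top.2 ⟨ENNReal.add_ne_top.2 ⟨h2, hVtop m⟩, ENNReal.one_ne_top⟩
  have hM1 : ∀ m, 1 ≤ M m := fun m => le_add_self
  obtain ⟨δ, hδ0, hδ⟩ := ENNReal.exists_pos_sum_of_countable (one_ne_zero (α := ℝ≥0∞)) ℕ
  set c : ℕ → ℝ≥0∞ := fun m => δ m / M m with hc
  have hc0 : ∀ m, c m ≠ 0 := fun m =>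
    ENNReal.div_ne_zero.2 ⟨by exact_mod_cast (hδ0 m).ne', hMtop m⟩
  have hcδ : ∀ m, c m ≤ δ m := fun m => ENNReal.div_le_of_le_mul (le_mul_of_one_le_right' (hM1 m))
  have hctop : ∀ m, c m ≠ ⊤ := fun m => ((hcδ m).trans_lt ENNReal.coe_lt_top).ne
  have hcM : ∀ m, c m * M m = δ m := fun m =>
    ENNReal.div_mul_cancel (one_pos.trans_le (hM1 m)).ne' (hMtop m)
  have hKm : ∀ m, MeasurableSet (K m) := fun m => (hK m).1.measurableSet
  -- The weight is w² = p/σ. On `K m` one has σ ≥ c m, so w² is locally integrable; and |∂F_j|²/w² ≤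
  -- (p + |J_j|) σ has integral at most the sum of c m · M m = δ m, hence at most 1.
  set σ : E → ℝ≥0∞ := fun x => ∑' m, (K m).indicator (fun _ => c m) x with hσ
  have hσm : Measurable σ := Measurable.tsum fun m => measurable_const.indicator (hKm m)
  have hσtop : ∀ x, σ x ≠ ⊤ := fun x =>
    ((ENNReal.tsum_le_tsum fun m => (Set.indicator_le_self' (fun _ _ => zero_le) x).trans
      (hcδ m)).trans_lt (hδ.trans ENNReal.one_lt_top)).ne
  have hσK : ∀ m, ∀ x ∈ K m, c m ≤ σ x := by
    intro m x hx
    have h1 := ENNReal.le_tsum (f := fun m => (K m).indicator (fun _ => c m) x) m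
    rwa [Set.indicator_of_mem hx] at h1
  have hσ0 : ∀ x ∈ D, 0 < (σ x).toReal := by
    intro x hx
    obtain ⟨m, hm⟩ := hKabs {x} (Set.singleton_subset_iff.2 hx) isCompact_singleton
    exact ENNReal.toReal_pos ((pos_iff_ne_zero.2 (hc0 m)).trans_le
      (hσK m x (hm rfl))).ne' (hσtop x)
  have hw2 : ∀ x, √(p x / (σ x).toReal) ^ 2 = p x / (σ x).toReal := fun x =>
    Real.sq_sqrt (div_nonneg (zero_le_one.trans (hp1 x)) ENNReal.toReal_nonneg)
  have hwm : Measurable fun x => p x / (σ x).toReal := hpm.div hσm.ennreal_toReal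
  refine ⟨fun x => √(p x / (σ x).toReal), hwm.sqrt, fun x hx =>
    Real.sqrt_pos.2 (div_pos (one_pos.trans_le (hp1 x)) (hσ0 x hx)), ?_, fun j k i => ?_⟩
  · simp only [hw2]
    refine locallyIntegrableOn_of_forall_isCompact hD fun C hCD hC => ?_
    obtain ⟨m, hm⟩ := hKabs C hCD hC
    refine Integrable.mono' ((hpi C hCD hC).div_const (c m).toReal) hwm.aestronglyMeasurable ?_
    filter_upwards [ae_restrict_mem hC.measurableSet] with x hx
    have h1 := ENNReal.toReal_mono (hσtop x) (hσK m x (hm hx))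
    have h2 : 0 < (c m).toReal := ENNReal.toReal_pos (hc0 m) (hctop m)
    have h3 : 0 ≤ p x := zero_le_one.trans (hp1 x)
    rw [Real.norm_of_nonneg (div_nonneg h3 ENNReal.toReal_nonneg)]
    gcongr
  · set u : E → ℝ := fun x => (jacobian (F j) x k i / √(p x / (σ x).toReal)) ^ 2 with hu
    have hGm := ((hF j).isWeakPartial k i).locallyIntegrable_deriv.aestronglyMeasurable
    have hum : AEStronglyMeasurable u (volume.restrict D) :=
      ((hGm.aemeasurable.div hwm.sqrt.aemeasurable).pow_const 2).aestronglyMeasurable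
    have hu0 : ∀ x, 0 ≤ u x := fun x => sq_nonneg _
    have hJm : AEMeasurable (fun x => ENNReal.ofReal |(jacobian (F j) x).det|)
        (volume.restrict D) := by
      have h1 : AEMeasurable (fun x (k i : Fin n) => jacobian (F j) x k i) (volume.restrict D) :=
        aemeasurable_pi_iff.2 fun k => aemeasurable_pi_iff.2 fun i =>
          ((hF j).isWeakPartial k i).locallyIntegrable_deriv.aestronglyMeasurable.aemeasurable
      exact (continuous_det.abs.measurable.comp_aemeasurable h1).ennreal_ofReal
    set g : E → ℝ≥0∞ := fun x => ENNReal.ofReal (p x) + ENNReal.ofReal |(jacobian (F j) x).det|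
      with hg
    have hgm : AEMeasurable g (volume.restrict D) := hpm.ennreal_ofReal.aemeasurable.add hJm
    have hpt : ∀ᵐ x ∂volume.restrict D, ENNReal.ofReal (u x) ≤ g x * σ x := by
      filter_upwards [hFp j, (hF j).ae_ne_top, ae_restrict_mem hD.measurableSet] with x hx hx' hxD
      have hpx : 0 < p x := one_pos.trans_le (hp1 x)
      have h1 := opNorm_pow_le_of_dilatationP_ne_top hn hx'
      have h2 : (dilatationP (F j) x).toReal ≤ p x :=
        ENNReal.toReal_le_of_le_ofReal hpx.le hx
      have h3 : opNorm (jacobian (F j) x) ^ n ≤ p x ^ (n - 1) * |(jacobian (F j) x).det| :=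
        h1.trans (mul_le_mul_of_nonneg_right (pow_le_pow_left₀ ENNReal.toReal_nonneg h2 _)
          (abs_nonneg _))
      have h4 := sq_le_of_pow_le hn (opNorm_nonneg _) hpx (abs_nonneg _) h3
      have h5 : jacobian (F j) x k i ^ 2 ≤ p x * (p x + |(jacobian (F j) x).det|) := by
        rw [← sq_abs]
        exact (pow_le_pow_left₀ (abs_nonneg _) (abs_apply_le_opNorm _ k i) 2).trans h4
      have h6 : u x ≤ (p x + |(jacobian (F j) x).det|) * (σ x).toReal := by
        rw [hu]
        simp only
        rw [div_pow, hw2, div_div_eq_mul_div, div_le_iff₀ hpx]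
        nlinarith [hσ0 x hxD]
      refine (ENNReal.ofReal_le_ofReal h6).trans_eq ?_
      rw [ENNReal.ofReal_mul (by positivity), ENNReal.ofReal_add hpx.le (abs_nonneg _),
        ENNReal.ofReal_toReal (hσtop x)]
    have hlint : ∫⁻ x in D, ENNReal.ofReal (u x) ≤ 1 := by
      calc ∫⁻ x in D, ENNReal.ofReal (u x) ≤ ∫⁻ x in D, g x * σ x := lintegral_mono_ae hpt
        _ = ∫⁻ x in D, ∑' m, (K m).indicator (fun x => c m * g x) x := by
          refine lintegral_congr fun x => ?_
          rw [hσ, ← ENNReal.tsum_mul_left]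
          refine tsum_congr fun m => ?_
          by_cases hx : x ∈ K m
          · rw [Set.indicator_of_mem hx, Set.indicator_of_mem hx, mul_comm]
          · rw [Set.indicator_of_notMem hx, Set.indicator_of_notMem hx, mul_zero]
        _ = ∑' m, ∫⁻ x in D, (K m).indicator (fun x => c m * g x) x :=
          lintegral_tsum fun m => (hgm.const_mul _).indicator (hKm m)
        _ ≤ ∑' m, (δ m : ℝ≥0∞) := by
          refine ENNReal.tsum_le_tsum fun m => ?_
          rw [lintegral_indicator (hKm m), Measure.restrict_restrict (hKm m),
            Set.inter_eq_left.2 (hK m).2, lintegral_const_mul' _ _ (hctop m), ← hcM m, hg,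
            lintegral_add_left hpm.ennreal_ofReal]
          gcongr
          rw [hM]
          refine le_trans (add_le_add le_rfl ?_) le_self_add
          exact ((hF j).lintegral_le _ (hKm m) (hK m).2).trans (hV m j)
        _ ≤ 1 := hδ.le
    have hui : IntegrableOn u D := (lintegral_ofReal_ne_top_iff_integrable hum
      (Eventually.of_forall hu0)).1 (hlint.trans_lt ENNReal.one_lt_top).ne
    refine ⟨hui, ?_⟩
    rw [integral_eq_lintegral_of_nonneg_ae (Eventually.of_forall hu0) hum]
    exact ENNReal.toReal_le_of_le_ofReal zero_le_one (by simpa using hlint)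

theorem IsWeakPartial.ae_eq {D : Set E} (hD : IsOpen D) {i : Fin n} {u v w : E → ℝ}
    (hv : IsWeakPartial D i u v) (hw : IsWeakPartial D i u w) :
    ∀ᵐ x ∂volume.restrict D, v x = w x := by
  have h1 := hD.ae_eq_zero_of_integral_contDiff_smul_eq_zero
    (hv.locallyIntegrable_deriv.sub hw.locallyIntegrable_deriv) (by
      intro φ hφ hφc hφD
      have hφm := memLp_top_of_continuous hφ.continuous hφc
      have h2 := (hv.integral_eq φ hφ hφc hφD).symm.trans (hw.integral_eq φ hφ hφc hφD)
      rw [← setIntegral_eq_integral_of_forall_compl_eq_zero (s := D)]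
      · simp only [smul_eq_mul, Pi.sub_apply, mul_comm (φ _), sub_mul]
        rw [integral_sub (integrableOn_mul_of_tsupport_subset hv.locallyIntegrable_deriv hφm hφc hφD)
          (integrableOn_mul_of_tsupport_subset hw.locallyIntegrable_deriv hφm hφc hφD)]
        linarith
      · intro x hx
        rw [image_eq_zero_of_notMem_tsupport fun hc => hx (hφD hc), zero_smul])
  filter_upwards [ae_restrict_of_ae h1, ae_restrict_mem hD.measurableSet] with x hx hxD
  exact sub_eq_zero.1 (hx hxD)

/-- The derivatives of a convergent sequence of maps with dominated dilatations converge weakly to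
the distributional derivatives of the limit. -/
theorem exists_isWeakPartial_tendstoWeaklyL1Loc (hn : 2 ≤ n) {D : Set E} (hD : IsOpen D)
    {F : ℕ → E → E} {f : E → E} (hF : ∀ j, FiniteDistortion D (F j))
    (hlim : TendstoLocallyUniformlyOn F f atTop D) {P : E → ℝ} (hP : LocallyIntegrableOn P D)
    (hFP : ∀ j, ∀ᵐ x ∂volume.restrict D, dilatationP (F j) x ≤ ENNReal.ofReal (P x))
    (i k : Fin n) :
    ∃ g : E → ℝ, IsWeakPartial D i (fun x => f x k) g ∧
      TendstoWeaklyL1Loc D (fun j x => jacobian (F j) x k i) g := by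
  obtain ⟨w, hwm, hw0, hw2, hwG⟩ := exists_weight hn hD hF hlim hP hFP
  have hfc : ContinuousOn f D := hlim.continuousOn (Frequently.of_forall fun j => (hF j).continuousOn)
  have hcomp : ∀ {h : E → E}, ContinuousOn h D → LocallyIntegrableOn (fun x => h x k) D :=
    fun hh => (((EuclideanSpace.proj k : E →L[ℝ] ℝ).continuous.comp_continuousOn
      hh).locallyIntegrableOn hD.measurableSet)
  -- With the derivative moved to φ, only uniform convergence on the support is needed; the limit
  -- identifies the weak derivative of f.
  have htest : ∀ φ : E → ℝ, ContDiff ℝ ∞ φ → HasCompactSupport φ → tsupport φ ⊆ D →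
      Tendsto (fun j => ∫ x in D, jacobian (F j) x k i * φ x) atTop
        (𝓝 (-∫ x in D, f x k * lineDeriv ℝ φ x (e i))) := by
    intro φ hφ hφc hφD
    have h0 : ∀ x, lineDeriv ℝ φ x (e i) = fderiv ℝ φ x (e i) := fun x =>
      (hφ.differentiable (by simp) x).lineDeriv_eq_fderiv
    have hψ : Continuous fun x => fderiv ℝ φ x (e i) :=
      (hφ.continuous_fderiv (by simp)).clm_apply continuous_const
    have hψc : HasCompactSupport fun x => fderiv ℝ φ x (e i) := hφc.fderiv_apply ℝ (e i)
    have hψD : tsupport (fun x => fderiv ℝ φ x (e i)) ⊆ D :=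
      (tsupport_fderiv_apply_subset ℝ (e i)).trans hφD
    have h1 := (tendsto_setIntegral_mul_of_tendstoUniformlyOn
      (u := fun j x => F j x k) (v := fun x => f x k)
      (fun j => hcomp (hF j).continuousOn) (hcomp hfc) hψ hψc hψD
      ((EuclideanSpace.proj k : E →L[ℝ] ℝ).uniformContinuous.comp_tendstoUniformlyOn
        (tendstoUniformlyOn_of_isCompact hlim hψc hψD))).neg
    simp only [← h0] at h1
    refine h1.congr fun j => ?_
    rw [((hF j).isWeakPartial k i).integral_eq φ hφ hφc hφD, neg_neg]
  obtain ⟨g, hg, hgφ⟩ := exists_weak_limit_of_weighted_bound hD hwm hw0 hw2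
    (G := fun j x => jacobian (F j) x k i)
    (fun j => ((hF j).isWeakPartial k i).locallyIntegrable_deriv.aestronglyMeasurable)
    (fun j => (hwG j k i).1) (fun j => (hwG j k i).2)
    (fun φ hφ hφc hφD => ⟨_, htest φ hφ hφc hφD⟩)
  refine ⟨g, ⟨hcomp hfc, hg, fun φ hφ hφc hφD => ?_⟩,
    fun j => ((hF j).isWeakPartial k i).locallyIntegrable_deriv, hg, hgφ⟩
  rw [← tendsto_nhds_unique (htest φ hφ hφc hφD)
    (hgφ φ (memLp_top_of_continuous hφ.continuous hφc) hφc hφD), neg_neg]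

theorem TendstoWeaklyL1Loc.congr {D : Set E} {G G' : ℕ → E → ℝ} {g g' : E → ℝ}
    (h : TendstoWeaklyL1Loc D G g) (hG : ∀ j, ∀ᵐ x ∂volume.restrict D, G j x = G' j x)
    (hg : ∀ᵐ x ∂volume.restrict D, g x = g' x) : TendstoWeaklyL1Loc D G' g' := by
  refine ⟨fun j => (h.1 j).congr (hG j), h.2.1.congr hg, fun φ hφ hφc hφD => ?_⟩
  have h1 := h.2.2 φ hφ hφc hφD
  have h2 : ∫ x in D, g x * φ x = ∫ x in D, g' x * φ x :=
    integral_congr_ae (hg.mono fun x hx => by simp only [hx])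
  rw [h2] at h1
  exact h1.congr fun j => integral_congr_ae ((hG j).mono fun x hx => by simp only [hx])

end WeakConvergence

end Dilatation

theorem mainTheorem12 (n : ℕ) (hn : 2 ≤ n)
    (D : Set (EuclideanSpace ℝ (Fin n))) (hD_open : IsOpen D) (hD_conn : IsConnected D)
    (F : ℕ → EuclideanSpace ℝ (Fin n) → EuclideanSpace ℝ (Fin n))
    (f : EuclideanSpace ℝ (Fin n) → EuclideanSpace ℝ (Fin n))
    (hF_homeo : ∀ j, Dilatation.IsHomeoInto D (F j))
    (hF_sobolev : ∀ j, Dilatation.MemW11Loc D (F j))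
    (hF_lim : TendstoLocallyUniformlyOn F f atTop D)
    (hf_diff : ∀ᵐ x ∂(volume.restrict D), DifferentiableAt ℝ f x)
    (P : EuclideanSpace ℝ (Fin n) → ℝ) (hP : LocallyIntegrableOn P D)
    (hFP : ∀ j, ∀ᵐ x ∂(volume.restrict D),
      Dilatation.dilatationP (F j) x ≤ ENNReal.ofReal (P x)) :
    (∀ᵐ x ∂(volume.restrict D),
      Dilatation.dilatationP f x ≤ limsup (fun j => Dilatation.dilatationP (F j) x) atTop) ∧
    (Dilatation.IsHomeoInto D f →
      Dilatation.MemW11Loc D f ∧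
      ∀ (i k : Fin n) (G : ℕ → EuclideanSpace ℝ (Fin n) → ℝ)
        (g : EuclideanSpace ℝ (Fin n) → ℝ),
        (∀ j, Dilatation.IsWeakPartial D i (fun x => F j x k) (G j)) →
        Dilatation.IsWeakPartial D i (fun x => f x k) g →
        Dilatation.TendstoWeaklyL1Loc D G g) := by
  have hF : ∀ j, Dilatation.FiniteDistortion D (F j) := fun j =>
    Dilatation.finiteDistortion_of_isHomeoInto hn hD_open (hF_homeo j) (hF_sobolev j)
      ((hFP j).mono fun x hx => (hx.trans_lt ENNReal.ofReal_lt_top).ne)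
  refine ⟨Dilatation.ae_dilatationP_le_limsup hn hD_open hF hF_lim hf_diff hP hFP, fun _ => ?_⟩
  have key := Dilatation.exists_isWeakPartial_tendstoWeaklyL1Loc hn hD_open hF hF_lim hP hFP
  refine ⟨fun k => ⟨?_, fun i => ?_⟩, fun i k G g hG hg => ?_⟩
  -- Any direction would do: only the local integrability of the component of f is extracted.
  · obtain ⟨g, hg, -⟩ := key ⟨0, by omega⟩ k
    exact hg.locallyIntegrable_fun
  · obtain ⟨g, hg, -⟩ := key i k
    exact ⟨g, hg⟩
  -- Weak derivatives are unique a.e., so convergence for the Jacobian entries passes to arbitrary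
  -- representatives.
  · obtain ⟨g', hg', hlim⟩ := key i k
    exact hlim.congr (fun j => ((hF j).isWeakPartial k i).ae_eq hD_open (hG j))
      (hg'.ae_eq hD_open hg)
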